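/- Let $\Omega\subset\mathbb R^n$ be a domain (a nonempty connected open set), and let $A\in L^\infty(\Omega,\mathcal L(\mathbb R^n))$ be normal, i.e. $A^*(x)A(x)=A(x)A^*(x)$ for a.e. $x\in\Omega$, and satisfy, for some constants $0<\lambda\le\Lambda<\infty$, $$\lambda|v|^2\le\langle A(x)v,v\rangle\ \text{ for all } v\in\mathbb R^n,\qquad \|A(x)\|<\Lambda,\qquad\text{for a.e. } x\in\Omega.$$ Let $(u_j)_{j\in\mathbb N}$ be a sequence of real-valued functions in $W^{1,2}_{\mathrm{loc}}(\Omega)$ that is locally uniformly bounded in $L^2$, i.e. $\sup_j\|u_j\|_{L^2(K)}<\infty$ for every compact $K\subset\Omega$, and such that every $u_j$ is a weak solution of $$\operatorname{div}\big(A(x)\nabla u_j(x)\big)=0\quad\text{on }\Omega,$$ i.e. $\int_\Omega\langle A\nabla u_j,\nabla\psi\rangle\,dx=0$ for all $\psi\in C_c^\infty(\Omega)$. Then for every simply connected open set $U$ with $C^\infty$ boundary whose closure is a compact subset of $\Omega$, there exist a subsequence $(u_{j_k})_k$ and a function $u\in W^{1,2}(U)$ such that $u_{j_k}\to u$ in the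 norm of $W^{1,2}(U)$ and $u$ is a weak solution of $\operatorname{div}(A\nabla u)=0$ on $U$. -/

import Mathlib

open MeasureTheory Filter Topology TopologicalSpace
open scoped ENNReal NNReal ContDiff Distributions

noncomputable section

/-- `f` belongs to `L²_loc(Ω)`: it is square integrable on every compact subset of `Ω`. -/
def MemL2loc {n : ℕ} {F : Type*} [NormedAddCommGroup F]
    (Ω : Opens (EuclideanSpace ℝ (Fin n))) (f : EuclideanSpace ℝ (Fin n) → F) : Prop :=
  ∀ K : Set (EuclideanSpace ℝ (Fin n)), IsCompact K → K ⊆ Ω → MemLp f 2 (volume.restrict K)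

/-- The locally integrable vector field `g` is the weak gradient of the locally integrable
function `u` on the open set `Ω`: `∫_Ω u ∂_v ψ = - ∫_Ω ψ ⟨g, v⟩` for all test functions
`ψ ∈ C_c^∞(Ω)` and all directions `v`. -/
structure HasWeakGradient {n : ℕ} (Ω : Opens (EuclideanSpace ℝ (Fin n)))
    (u : EuclideanSpace ℝ (Fin n) → ℝ)
    (g : EuclideanSpace ℝ (Fin n) → EuclideanSpace ℝ (Fin n)) : Prop where
  locallyIntegrableOn : LocallyIntegrableOn u (Ω : Set (EuclideanSpace ℝ (Fin n)))
  locallyIntegrableOn_grad : LocallyIntegrableOn g (Ω : Set (EuclideanSpace ℝ (Fin n)))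
  integral_eq : ∀ (ψ : 𝓓(Ω, ℝ)) (v : EuclideanSpace ℝ (Fin n)),
    ∫ x in Ω, u x * fderiv ℝ ψ x v = - ∫ x in Ω, ψ x * inner ℝ (g x) v

/-- The local Sobolev space `W^{1,2}_loc(Ω)`. -/
def MemW12loc {n : ℕ} (Ω : Opens (EuclideanSpace ℝ (Fin n)))
    (u : EuclideanSpace ℝ (Fin n) → ℝ) : Prop :=
  MemL2loc Ω u ∧ ∃ g, HasWeakGradient Ω u g ∧ MemL2loc Ω g

/-- The Sobolev space `W^{1,2}(U)`. -/
def MemW12 {n : ℕ} (U : Opens (EuclideanSpace ℝ (Fin n)))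
    (u : EuclideanSpace ℝ (Fin n) → ℝ) : Prop :=
  MemLp u 2 (volume.restrict U) ∧ ∃ g, HasWeakGradient U u g ∧ MemLp g 2 (volume.restrict U)

/-- The extended `W^{1,2}(U)` norm `(‖u‖²_{L²(U)} + ‖∇u‖²_{L²(U)})^{1/2}`. The weak gradient is
unique up to null sets, so the infimum runs over equal values; it is `∞` if `u` has no weak
gradient on `U`. -/
def eW12norm {n : ℕ} (U : Opens (EuclideanSpace ℝ (Fin n)))
    (u : EuclideanSpace ℝ (Fin n) → ℝ) : ℝ≥0∞ :=
  ⨅ (g : EuclideanSpace ℝ (Fin n) → EuclideanSpace ℝ (Fin n)) (_ : HasWeakGradient U u g),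
    (eLpNorm u 2 (volume.restrict U) ^ 2 + eLpNorm g 2 (volume.restrict U) ^ 2) ^ (1 / 2 : ℝ)

/-- `u` is a weak solution of `div (A ∇u) = 0` on `Ω`: it has a weak gradient `∇u ∈ L²_loc(Ω)`
and `∫_Ω ⟨A ∇u, ∇ψ⟩ = 0` for all `ψ ∈ C_c^∞(Ω)`. -/
def IsWeakSolutionDiv {n : ℕ} (Ω : Opens (EuclideanSpace ℝ (Fin n)))
    (A : EuclideanSpace ℝ (Fin n) → EuclideanSpace ℝ (Fin n) →L[ℝ] EuclideanSpace ℝ (Fin n))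
    (u : EuclideanSpace ℝ (Fin n) → ℝ) : Prop :=
  ∃ g, HasWeakGradient Ω u g ∧ MemL2loc Ω g ∧
    ∀ ψ : 𝓓(Ω, ℝ), ∫ x in Ω, inner ℝ (A x (g x)) (gradient ψ x) = 0

/-- The open set `U` has a `C^∞` boundary: near each of its boundary points it is the sublevel set
`{ρ < 0}` of a smooth function with nonvanishing differential at that point. -/
def HasSmoothBoundary {n : ℕ} (U : Opens (EuclideanSpace ℝ (Fin n))) : Prop :=
  ∀ p ∈ frontier (U : Set (EuclideanSpace ℝ (Fin n))),
    ∃ (V : Set (EuclideanSpace ℝ (Fin n))) (ρ : EuclideanSpace ℝ (Fin n) → ℝ),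
      IsOpen V ∧ p ∈ V ∧ ContDiffOn ℝ ∞ ρ V ∧ fderiv ℝ ρ p ≠ 0 ∧
        (U : Set (EuclideanSpace ℝ (Fin n))) ∩ V = {x ∈ V | ρ x < 0}

end

/-! Everything rests on an interior energy estimate used twice. Caccioppoli's inequality
(`eLpNorm_smul_weakGradient_le`) bounds the gradient of a weak solution, weighted by a cutoff, by
the `L²` norm of the solution on the support of that cutoff. Applied to each `u j`, it makes `η * u
j` bounded in `W^{1,2}`, so Rellich's theorem (`exists_subseq_cauchy_eLpNorm`) gives a subsequence
that is Cauchy in `L²` near `closure U`. The equation is linear, so differences `u j - u k` are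
again weak solutions; a second application turns `L²` smallness on a larger compact set into
smallness of the gradients on `U` (`exists_subseq_cauchy_weakSolution`). Weak gradients and the
equation survive strong `L²` limits.

Rellich's theorem is proved by mollification. A gradient bound controls translations in `L²`, so
mollifying at a small scale moves all terms by a uniformly small amount, while mollification at a
fixed scale turns weak convergence of functions with common compact support into strong convergence.
Weak convergence comes from Banach-Alaoglu. Mollification also lets weak equations be tested with
`W^{1,2}` functions, as Caccioppoli requires. -/

set_option linter.unusedSectionVars false

/-! ### Jensen and Minkowski inequalities for averages. -/

section Averaging

variable {X Y H : Type*} [MeasurableSpace X] [MeasurableSpace Y] [NormedAddCommGroup H]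
  {μ : Measure X} {m : Measure Y}

lemma eLpNorm_two_sq_eq_lintegral (f : X → H) : eLpNorm f 2 μ ^ 2 = ∫⁻ x, ‖f x‖ₑ ^ 2 ∂μ := by
  have h := eLpNorm_nnreal_pow_eq_lintegral (μ := μ) (f := f) (p := 2) two_ne_zero
  simp only [NNReal.coe_ofNat, ENNReal.coe_ofNat, ENNReal.rpow_ofNat] at h
  exact h

variable [NormedSpace ℝ H]

/-- On a probability space the `L¹` norm is at most the `L²` norm; a nonmeasurable `f` has integral
`0` by convention. -/
lemma enorm_integral_sq_le [IsProbabilityMeasure m] (f : Y → H) :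
    ‖∫ y, f y ∂m‖ₑ ^ 2 ≤ ∫⁻ y, ‖f y‖ₑ ^ 2 ∂m := by
  by_cases hf : AEStronglyMeasurable f m
  · rw [← eLpNorm_two_sq_eq_lintegral]
    gcongr
    refine (enorm_integral_le_lintegral_enorm f).trans ?_
    rw [← eLpNorm_one_eq_lintegral_enorm]
    exact eLpNorm_le_eLpNorm_of_exponent_le (by norm_num) hf
  · rw [integral_non_aestronglyMeasurable hf]
    simp

/-- Minkowski's integral inequality in `L²`, for averages over a probability measure. -/
lemma eLpNorm_integral_sq_le [SFinite μ] [IsProbabilityMeasure m] {F : X → Y → H}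
    (hF : AEStronglyMeasurable (Function.uncurry F) (μ.prod m)) :
    eLpNorm (fun x => ∫ y, F x y ∂m) 2 μ ^ 2 ≤ ∫⁻ y, eLpNorm (fun x => F x y) 2 μ ^ 2 ∂m := by
  simp_rw [eLpNorm_two_sq_eq_lintegral]
  rw [lintegral_lintegral_swap (f := fun y x => ‖F x y‖ₑ ^ 2)]
  · exact lintegral_mono fun x => enorm_integral_sq_le _
  · exact (hF.enorm.pow_const 2).prod_swap

lemma eLpNorm_integral_le [SFinite μ] [IsProbabilityMeasure m] {F : X → Y → H}
    (hF : AEStronglyMeasurable (Function.uncurry F) (μ.prod m)) {c : ℝ≥0∞}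
    (hc : ∀ᵐ y ∂m, eLpNorm (fun x => F x y) 2 μ ≤ c) :
    eLpNorm (fun x => ∫ y, F x y ∂m) 2 μ ≤ c := by
  rw [← ENNReal.pow_le_pow_left_iff two_ne_zero]
  refine (eLpNorm_integral_sq_le hF).trans ?_
  calc ∫⁻ y, eLpNorm (fun x => F x y) 2 μ ^ 2 ∂m ≤ ∫⁻ _, c ^ 2 ∂m :=
        lintegral_mono_ae (hc.mono fun y hy => by gcongr)
    _ = c ^ 2 := by simp

end Averaging

/-! ### Mollification and translation in `L²`. -/

section Mollification

variable {E H : Type*} [NormedAddCommGroup E] [InnerProductSpace ℝ E] [FiniteDimensional ℝ E]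
  [MeasurableSpace E] [BorelSpace E] [NormedAddCommGroup H] [NormedSpace ℝ H]
  {μ : Measure E} [μ.IsAddHaarMeasure]

/-- The mollification of `f` by the normalized bump function `φ`. -/
noncomputable def mollify (μ : Measure E) (φ : ContDiffBump (0 : E)) (f : E → H) : E → H :=
  convolution (φ.normed μ) f (ContinuousLinearMap.lsmul ℝ ℝ) μ

/-- The probability measure whose density is a normalized bump function. -/
noncomputable def ContDiffBump.toMeasure (μ : Measure E) (φ : ContDiffBump (0 : E)) : Measure E :=
  μ.withDensity fun y => ENNReal.ofReal (φ.normed μ y)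

lemma ContDiffBump.isProbabilityMeasure_toMeasure (φ : ContDiffBump (0 : E)) :
    IsProbabilityMeasure (φ.toMeasure μ) := by
  constructor
  rw [toMeasure, withDensity_apply _ MeasurableSet.univ, Measure.restrict_univ,
    ← ofReal_integral_eq_lintegral_ofReal φ.integrable_normed
      (Eventually.of_forall φ.nonneg_normed), φ.integral_normed, ENNReal.ofReal_one]

lemma ContDiffBump.toMeasure_absolutelyContinuous (φ : ContDiffBump (0 : E)) :
    φ.toMeasure μ ≪ μ :=
  withDensity_absolutelyContinuous _ _

lemma ContDiffBump.ae_toMeasure (φ : ContDiffBump (0 : E)) :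
    ∀ᵐ y ∂(φ.toMeasure μ), ‖y‖ < φ.rOut := by
  rw [toMeasure, ae_withDensity_iff (φ.continuous_normed.measurable.ennreal_ofReal)]
  refine Eventually.of_forall fun y hy => ?_
  have : y ∈ Function.support (φ.normed μ) := by
    intro h
    simp [h] at hy
  simpa [φ.support_normed_eq] using this

/-- Reading a mollification as an average of translates over a probability measure makes the
averaging inequalities applicable. -/
lemma mollify_apply (φ : ContDiffBump (0 : E)) (f : E → H) (x : E) :
    mollify μ φ f x = ∫ y, f (x - y) ∂(φ.toMeasure μ) := by
  rw [ContDiffBump.toMeasure, integral_withDensity_eq_integral_toReal_smul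
    (φ.continuous_normed.measurable.ennreal_ofReal) (by simp)]
  simp [mollify, convolution, ENNReal.toReal_ofReal (φ.nonneg_normed _)]

lemma mollify_apply' (φ : ContDiffBump (0 : E)) (f : E → H) (x : E) :
    mollify μ φ f x = ∫ y, φ.normed μ (x - y) • f y ∂μ := by
  rw [mollify, convolution_eq_swap]
  simp

lemma aestronglyMeasurable_translate {f : E → H} (hf : AEStronglyMeasurable f μ)
    (φ : ContDiffBump (0 : E)) :
    AEStronglyMeasurable (fun p : E × E => f (p.1 - p.2)) (μ.prod (φ.toMeasure μ)) := by
  have := φ.isProbabilityMeasure_toMeasure (μ := μ)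
  refine (hf.comp_quasiMeasurePreserving (quasiMeasurePreserving_sub_of_right_invariant μ μ)).mono_ac ?_
  exact Measure.AbsolutelyContinuous.rfl.prod φ.toMeasure_absolutelyContinuous

lemma eLpNorm_comp_sub_right {f : E → H} (hf : AEStronglyMeasurable f μ) (y : E) {p : ℝ≥0∞} :
    eLpNorm (fun x => f (x - y)) p μ = eLpNorm f p μ :=
  eLpNorm_comp_measurePreserving (g := f) (f := fun x => x - y) hf
    (measurePreserving_sub_right μ y)

lemma eLpNorm_mollify_le {f : E → H} (hf : AEStronglyMeasurable f μ) (φ : ContDiffBump (0 : E)) :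
    eLpNorm (mollify μ φ f) 2 μ ≤ eLpNorm f 2 μ := by
  have := φ.isProbabilityMeasure_toMeasure (μ := μ)
  rw [funext (mollify_apply φ f)]
  exact eLpNorm_integral_le (F := fun x y => f (x - y)) (aestronglyMeasurable_translate hf φ)
    (Eventually.of_forall fun y => (eLpNorm_comp_sub_right hf y).le)

lemma contDiff_mollify {f : E → H} [CompleteSpace H] (hf : LocallyIntegrable f μ)
    (φ : ContDiffBump (0 : E)) : ContDiff ℝ ∞ (mollify μ φ f) :=
  HasCompactSupport.contDiff_convolution_left (n := ⊤) _ φ.hasCompactSupport_normed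
    (φ.contDiff_normed (n := ⊤)) hf

lemma integrable_translate {f : E → H} (hf : LocallyIntegrable f μ) (φ : ContDiffBump (0 : E))
    (x : E) : Integrable (fun y => f (x - y)) (φ.toMeasure μ) := by
  rw [ContDiffBump.toMeasure, integrable_withDensity_iff_integrable_smul'
    (φ.continuous_normed.measurable.ennreal_ofReal) (by simp)]
  have := HasCompactSupport.convolutionExists_left (ContinuousLinearMap.lsmul ℝ ℝ (E := H))
    (φ.hasCompactSupport_normed (μ := μ)) φ.continuous_normed hf x
  simpa [ConvolutionExistsAt, ENNReal.toReal_ofReal (φ.nonneg_normed _)] using this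

/-- The mollification error is the average of the translation errors `f (x - y) - f x`, so a bound
uniform over small `y` passes to it. -/
lemma eLpNorm_mollify_sub_le [CompleteSpace H] {f : E → H} (hf : LocallyIntegrable f μ)
    (φ : ContDiffBump (0 : E)) {c : ℝ≥0∞}
    (hc : ∀ y, ‖y‖ < φ.rOut → eLpNorm (fun x => f (x - y) - f x) 2 μ ≤ c) :
    eLpNorm (mollify μ φ f - f) 2 μ ≤ c := by
  have := φ.isProbabilityMeasure_toMeasure (μ := μ)
  have h : mollify μ φ f - f = fun x => ∫ y, (f (x - y) - f x) ∂(φ.toMeasure μ) := by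
    ext x
    rw [integral_sub (integrable_translate hf φ x) (integrable_const _), ← mollify_apply]
    simp
  rw [h]
  refine eLpNorm_integral_le (F := fun x y => f (x - y) - f x) ?_ (φ.ae_toMeasure.mono hc)
  exact (aestronglyMeasurable_translate hf.aestronglyMeasurable φ).sub
    (hf.aestronglyMeasurable.comp_fst)

/-- Continuity of translations in `L²`. -/
lemma tendsto_eLpNorm_translate_sub {f : E → H} (hf : MemLp f 2 μ) :
    Tendsto (fun y => eLpNorm (fun x => f (x - y) - f x) 2 μ) (𝓝 0) (𝓝 0) := by
  have : Fact (1 ≤ (2 : ℝ≥0∞)) := ⟨by norm_num⟩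
  -- Translations depend continuously on `y` in `C(E, E)` and preserve the measure; composition with
  -- such a family is continuous in `Lp`.
  let g : E → C(E, E) := fun y => ⟨fun x => x - y, by fun_prop⟩
  have hg : Continuous g := by
    refine ContinuousMap.continuous_of_continuous_uncurry _ ?_
    simp only [g, Function.uncurry_def, ContinuousMap.coe_mk]
    fun_prop
  have hgm : ∀ y, MeasurePreserving (g y) μ μ := fun y => measurePreserving_sub_right μ y
  have h := (continuous_const (y := hf.toLp f)).compMeasurePreservingLp hg hgm (by norm_num)
  have h0 := (h.tendsto 0).sub_const (hf.toLp f)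
  have h1 : Lp.compMeasurePreserving (g 0) (hgm 0) (hf.toLp f) = hf.toLp f := by
    rw [Lp.toLp_compMeasurePreserving]
    congr 1
    ext x
    simp [g]
  rw [h1, sub_self, tendsto_zero_iff_norm_tendsto_zero] at h0
  have h2 := ENNReal.tendsto_ofReal h0
  rw [ENNReal.ofReal_zero] at h2
  refine h2.congr fun y => ?_
  rw [Lp.toLp_compMeasurePreserving, ← MemLp.toLp_sub, Lp.norm_toLp, ENNReal.ofReal_toReal]
  · rfl
  · exact ((hf.comp_measurePreserving (hgm y)).sub hf).eLpNorm_ne_top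

/-- A bump function centered at zero with outer radius `ε`. -/
noncomputable def bumpOfRadius (E : Type*) [NormedAddCommGroup E] (ε : ℝ) (hε : 0 < ε) :
    ContDiffBump (0 : E) :=
  ⟨ε / 2, ε, by positivity, by linarith⟩

/-- A sequence of bump functions whose supports shrink to zero. -/
noncomputable def bumpSeq (E : Type*) [NormedAddCommGroup E] (k : ℕ) : ContDiffBump (0 : E) :=
  bumpOfRadius E (1 / ((k : ℝ) + 1)) Nat.one_div_pos_of_nat

lemma tendsto_bumpSeq_rOut : Tendsto (fun k => (bumpSeq E k).rOut) atTop (𝓝 0) :=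
  tendsto_one_div_add_atTop_nhds_zero_nat

lemma tendsto_eLpNorm_mollify_sub [CompleteSpace H] {f : E → H} (hf : MemLp f 2 μ) :
    Tendsto (fun k => eLpNorm (mollify μ (bumpSeq E k) f - f) 2 μ) atTop (𝓝 0) := by
  rw [ENNReal.tendsto_nhds_zero]
  intro ε hε
  obtain ⟨δ, hδ, h⟩ := Metric.eventually_nhds_iff.1
    ((ENNReal.tendsto_nhds_zero.1 (tendsto_eLpNorm_translate_sub hf)) ε hε)
  filter_upwards [(tendsto_bumpSeq_rOut (E := E)).eventually_lt_const hδ] with k hk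
  exact eLpNorm_mollify_sub_le (μ := μ) (hf.locallyIntegrable (by norm_num)) _ fun y hy =>
    h (by simpa using hy.trans hk)

end Mollification

/-! ### Mollified weak gradients and the translation estimate. -/

section WeakGradient

variable {n : ℕ}

/-- The derivative falls on the bump, and `t ↦ φ (x - t)` is a test function, so the definition of
the weak gradient moves the derivative onto `v`. -/
lemma HasWeakGradient.hasFDerivAt_mollify {v : EuclideanSpace ℝ (Fin n) → ℝ}
    {G : EuclideanSpace ℝ (Fin n) → EuclideanSpace ℝ (Fin n)} (h : HasWeakGradient ⊤ v G)
    (φ : ContDiffBump (0 : EuclideanSpace ℝ (Fin n))) (x : EuclideanSpace ℝ (Fin n)) :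
    HasFDerivAt (mollify volume φ v) (innerSL ℝ (mollify volume φ G x)) x := by
  have hv : LocallyIntegrable v volume := by
    simpa [locallyIntegrableOn_univ] using h.locallyIntegrableOn
  have hG : LocallyIntegrable G volume := by
    simpa [locallyIntegrableOn_univ] using h.locallyIntegrableOn_grad
  have hρ : ContDiff ℝ ∞ (φ.normed volume) := φ.contDiff_normed (n := ⊤)
  have key := HasCompactSupport.hasFDerivAt_convolution_right
    (ContinuousLinearMap.lsmul ℝ ℝ (E := ℝ)).flip (φ.hasCompactSupport_normed (μ := volume)) hv
    (hρ.of_le (by norm_num)) x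
  rw [convolution_flip] at key
  refine key.congr_fderiv ?_
  ext1 w
  rw [convolution_precompR_apply _ hv ((φ.hasCompactSupport_normed).fderiv ℝ)
    (hρ.continuous_fderiv (by norm_num)), innerSL_apply_apply, mollify_apply']
  have hψ : ContDiff ℝ ∞ (fun t => φ.normed volume (x - t)) :=
    hρ.comp (contDiff_const.sub contDiff_id)
  have hψc : HasCompactSupport (fun t => φ.normed volume (x - t)) :=
    (φ.hasCompactSupport_normed (μ := volume)).comp_homeomorph (Homeomorph.subLeft x)
  have hI : Integrable (fun t => φ.normed volume (x - t) • G t) volume :=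
    hG.integrable_smul_left_of_hasCompactSupport hψ.continuous hψc
  have hw := h.integral_eq ⟨_, hψ, hψc, by simp⟩ w
  -- The minus sign from the reflection cancels the one in the weak gradient identity.
  have hd : ∀ t, fderiv ℝ (fun t => φ.normed volume (x - t)) t w
      = - fderiv ℝ (φ.normed volume) (x - t) w := by
    intro t
    have h1 : HasFDerivAt (fun t => x - t)
        (-(ContinuousLinearMap.id ℝ (EuclideanSpace ℝ (Fin n)))) t := (hasFDerivAt_id t).const_sub x
    have h2 := ((hρ.differentiable (by norm_num)) (x - t)).hasFDerivAt.comp t h1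
    have h3 := h2.fderiv
    simp only [Function.comp_def] at h3
    rw [h3]
    simp
  simp only [TestFunction.coe_mk, Opens.coe_top, Measure.restrict_univ] at hw
  simp_rw [hd, mul_neg, integral_neg, neg_inj] at hw
  rw [real_inner_comm, ← integral_inner hI, convolution]
  simp only [ContinuousLinearMap.flip_apply, ContinuousLinearMap.lsmul_apply, smul_eq_mul]
  simp_rw [mul_comm (fderiv ℝ _ _ _)]
  rw [hw]
  refine integral_congr_ae (Eventually.of_forall fun t => ?_)
  simp only [real_inner_smul_right, real_inner_comm w]

lemma HasWeakGradient.gradient_mollify {v : EuclideanSpace ℝ (Fin n) → ℝ}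
    {G : EuclideanSpace ℝ (Fin n) → EuclideanSpace ℝ (Fin n)} (h : HasWeakGradient ⊤ v G)
    (φ : ContDiffBump (0 : EuclideanSpace ℝ (Fin n))) :
    gradient (mollify volume φ v) = mollify volume φ G := by
  ext1 x
  refine HasGradientAt.gradient ?_
  rw [hasGradientAt_iff_hasFDerivAt]
  exact h.hasFDerivAt_mollify φ x

/-- By the fundamental theorem of calculus along the segment from `x` to `x - y`, the increment is
an average of directional derivatives; Minkowski and translation invariance finish. -/
lemma eLpNorm_translate_sub_le_of_contDiff {f : EuclideanSpace ℝ (Fin n) → ℝ}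
    (hf : ContDiff ℝ 1 f) (y : EuclideanSpace ℝ (Fin n)) :
    eLpNorm (fun x => f (x - y) - f x) 2 volume
      ≤ ENNReal.ofReal ‖y‖ * eLpNorm (fderiv ℝ f) 2 volume := by
  have hc : Continuous (fderiv ℝ f) := hf.continuous_fderiv (by norm_num)
  have h : (fun x => f (x - y) - f x)
      = fun x => ∫ t, fderiv ℝ f (x - t • y) (-y) ∂(volume.restrict (Set.Ioc (0 : ℝ) 1)) := by
    ext x
    rw [← intervalIntegral.integral_of_le zero_le_one,
      intervalIntegral.integral_eq_sub_of_hasDerivAt (f := fun t : ℝ => f (x - t • y))]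
    · simp
    · intro t _
      have h1 : HasDerivAt (fun t : ℝ => x - t • y) (-y) t := by
        simpa using ((hasDerivAt_id t).smul_const y).const_sub x
      exact ((hf.differentiable (by norm_num)) _).hasFDerivAt.comp_hasDerivAt t h1
    · exact Continuous.intervalIntegrable (by fun_prop) _ _
  have : IsProbabilityMeasure (volume.restrict (Set.Ioc (0 : ℝ) 1)) := ⟨by simp⟩
  rw [h]
  refine eLpNorm_integral_le (F := fun x t => fderiv ℝ f (x - t • y) (-y))
    (Continuous.aestronglyMeasurable (by simp only [Function.uncurry_def]; fun_prop))
    (Eventually.of_forall fun t => ?_)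
  rw [← eLpNorm_comp_sub_right hc.aestronglyMeasurable (t • y)]
  refine eLpNorm_le_mul_eLpNorm_of_ae_le_mul (Eventually.of_forall fun x => ?_) _
  simpa [mul_comm] using (fderiv ℝ f (x - t • y)).le_opNorm (-y)

/-- Translations move a `W^{1,2}` function in `L²` by at most the norm of its weak gradient. -/
lemma HasWeakGradient.eLpNorm_translate_sub_le {v : EuclideanSpace ℝ (Fin n) → ℝ}
    {G : EuclideanSpace ℝ (Fin n) → EuclideanSpace ℝ (Fin n)} (h : HasWeakGradient ⊤ v G)
    (hv : MemLp v 2 volume) (y : EuclideanSpace ℝ (Fin n)) :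
    eLpNorm (fun x => v (x - y) - v x) 2 volume
      ≤ ENNReal.ofReal ‖y‖ * eLpNorm G 2 volume := by
  have hvl : LocallyIntegrable v volume := by
    simpa [locallyIntegrableOn_univ] using h.locallyIntegrableOn
  have hGl : LocallyIntegrable G volume := by
    simpa [locallyIntegrableOn_univ] using h.locallyIntegrableOn_grad
  set V : ℕ → EuclideanSpace ℝ (Fin n) → ℝ := fun k => mollify volume (bumpSeq _ k) v with hV
  have hVs : ∀ k, ContDiff ℝ ∞ (V k) := fun k => contDiff_mollify hvl _
  have ha := tendsto_eLpNorm_mollify_sub hv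
  have hb : Tendsto (fun k => eLpNorm (V k - v) 2 volume +
      (ENNReal.ofReal ‖y‖ * eLpNorm G 2 volume + eLpNorm (V k - v) 2 volume)) atTop
      (𝓝 (0 + (ENNReal.ofReal ‖y‖ * eLpNorm G 2 volume + 0))) :=
    ha.add (tendsto_const_nhds.add ha)
  rw [zero_add, add_zero] at hb
  refine ge_of_tendsto' hb fun k => ?_
  have hVm : AEStronglyMeasurable (V k) volume := (hVs k).continuous.aestronglyMeasurable
  have hVt : AEStronglyMeasurable (fun x => V k (x - y)) volume :=
    ((hVs k).continuous.comp (by fun_prop)).aestronglyMeasurable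
  have hm : AEStronglyMeasurable (fun x => (V k - v) (x - y)) volume :=
    (hVm.sub hv.1).comp_measurePreserving (measurePreserving_sub_right volume y)
  -- The outer terms are approximation errors that vanish as `k → ∞`; the middle one is the smooth
  -- case.
  have e1 : (fun x => v (x - y) - v x) =
      (fun x => -(V k - v) (x - y)) + ((fun x => V k (x - y) - V k x) + (V k - v)) := by
    ext x
    simp only [Pi.add_apply, Pi.sub_apply]
    ring
  rw [e1]
  refine (eLpNorm_add_le hm.neg ((hVt.sub hVm).add (hVm.sub hv.1)) (by norm_num)).trans ?_
  gcongr
  · rw [← eLpNorm_comp_sub_right (hVm.sub hv.1) y]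
    exact (eLpNorm_neg (fun x => (V k - v) (x - y)) 2 volume).le
  · refine (eLpNorm_add_le (hVt.sub hVm) (hVm.sub hv.1) (by norm_num)).trans ?_
    gcongr
    refine (eLpNorm_translate_sub_le_of_contDiff ((hVs k).of_le (by norm_num)) y).trans ?_
    gcongr
    refine le_trans (le_of_eq ?_) (eLpNorm_mollify_le hGl.aestronglyMeasurable (bumpSeq _ k))
    refine eLpNorm_congr_norm_ae (Eventually.of_forall fun x => ?_)
    rw [(h.hasFDerivAt_mollify _ x).fderiv, innerSL_apply_norm]

end WeakGradient

/-! ### Rellich-Kolmogorov compactness. -/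

section Rellich

variable {E : Type*} [NormedAddCommGroup E] [InnerProductSpace ℝ E] [FiniteDimensional ℝ E]
  [MeasurableSpace E] [BorelSpace E] {μ : Measure E} [μ.IsAddHaarMeasure]

/-- Weak sequential compactness of bounded sets in `L²`. -/
lemma exists_subseq_weakly_convergent {v : ℕ → E → ℝ} {C : ℝ≥0} (hv : ∀ j, MemLp (v j) 2 μ)
    (hC : ∀ j, eLpNorm (v j) 2 μ ≤ C) :
    ∃ σ : ℕ → ℕ, StrictMono σ ∧ ∀ f : E → ℝ, MemLp f 2 μ →
      ∃ l : ℝ, Tendsto (fun k => ∫ x, v (σ k) x * f x ∂μ) atTop (𝓝 l) := by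
  have : Fact (1 ≤ (2 : ℝ≥0∞)) := ⟨by norm_num⟩
  have : Fact ((2 : ℝ≥0∞) ≠ ⊤) := ⟨by norm_num⟩
  -- The Riesz isometry places the sequence in a dual ball, which is weak-* sequentially compact
  -- because `Lp` is separable.
  let T : ℕ → WeakDual ℝ (Lp ℝ 2 μ) := fun j =>
    StrongDual.toWeakDual (InnerProductSpace.toDual ℝ (Lp ℝ 2 μ) ((hv j).toLp (v j)))
  have hT : ∀ j, T j ∈ WeakDual.toStrongDual (𝕜 := ℝ) (E := Lp ℝ 2 μ) ⁻¹'
      Metric.closedBall 0 (C : ℝ) := by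
    intro j
    simp only [Set.mem_preimage, mem_closedBall_zero_iff]
    change ‖InnerProductSpace.toDual ℝ (Lp ℝ 2 μ) ((hv j).toLp (v j))‖ ≤ C
    rw [LinearIsometryEquiv.norm_map, Lp.norm_toLp]
    exact ENNReal.toReal_le_coe_of_le_coe (hC j)
  obtain ⟨a, -, σ, hσ, ha⟩ := WeakDual.isSeqCompact_closedBall ℝ (Lp ℝ 2 μ) 0 (C : ℝ) hT
  refine ⟨σ, hσ, fun f hf => ⟨a (hf.toLp f), ?_⟩⟩
  have h := ((WeakDual.eval_continuous (𝕜 := ℝ) (hf.toLp f)).tendsto a).comp ha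
  refine h.congr fun k => ?_
  change InnerProductSpace.toDual ℝ (Lp ℝ 2 μ) ((hv (σ k)).toLp (v (σ k))) (hf.toLp f) = _
  rw [InnerProductSpace.toDual_apply_apply, L2.inner_def]
  refine integral_congr_ae ?_
  filter_upwards [(hv (σ k)).coeFn_toLp, hf.coeFn_toLp] with x h1 h2
  rw [h1, h2]
  simp [mul_comm]

/-- The bump density is bounded by `S`, so the averaging measure is at most `S • μ`. The resulting
pointwise bound is uniform in `x` and serves as a dominating constant. -/
lemma enorm_mollify_le (φ : ContDiffBump (0 : E)) : ∃ S : ℝ≥0, ∀ f : E → ℝ,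
    AEStronglyMeasurable f μ → ∀ x, ‖mollify μ φ f x‖ₑ ^ 2 ≤ S * eLpNorm f 2 μ ^ 2 := by
  obtain ⟨S, hS⟩ := (φ.hasCompactSupport_normed (μ := μ)).exists_bound_of_continuous
    φ.continuous_normed
  refine ⟨S.toNNReal, fun f hf x => ?_⟩
  have := φ.isProbabilityMeasure_toMeasure (μ := μ)
  rw [mollify_apply]
  refine (enorm_integral_sq_le _).trans ?_
  have hm : φ.toMeasure μ ≤ (S.toNNReal : ℝ≥0∞) • μ := by
    rw [ContDiffBump.toMeasure, ← withDensity_const]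
    refine withDensity_mono (Eventually.of_forall fun y => ?_)
    exact ENNReal.ofReal_le_ofReal ((le_abs_self _).trans (hS y))
  calc ∫⁻ y, ‖f (x - y)‖ₑ ^ 2 ∂(φ.toMeasure μ)
      ≤ ∫⁻ y, ‖f (x - y)‖ₑ ^ 2 ∂((S.toNNReal : ℝ≥0∞) • μ) := lintegral_mono' hm le_rfl
    _ = S.toNNReal * ∫⁻ y, ‖f (x - y)‖ₑ ^ 2 ∂μ := by rw [lintegral_smul_measure, smul_eq_mul]
    _ = S.toNNReal * eLpNorm f 2 μ ^ 2 := by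
        rw [eLpNorm_two_sq_eq_lintegral, lintegral_sub_left_eq_self (fun y => ‖f y‖ₑ ^ 2) x]

lemma mollify_eq_zero_of_notMem {K : Set E} {f : E → ℝ} (hf : Function.support f ⊆ K)
    (φ : ContDiffBump (0 : E)) {x : E} (hx : x ∉ Metric.cthickening φ.rOut K) :
    mollify μ φ f x = 0 := by
  rw [mollify_apply]
  refine integral_eq_zero_of_ae (φ.ae_toMeasure.mono fun y hy => ?_)
  by_contra h
  refine hx (Metric.mem_cthickening_of_dist_le x (x - y) _ K (hf h) ?_)
  simpa [dist_eq_norm] using hy.le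

/-- Each value of a mollification is the pairing with a fixed `L²` function, so weak convergence
gives pointwise convergence. The uniform bound and the common compact support then allow dominated
convergence. -/
lemma exists_tendsto_mollify {K : Set E} (hK : IsCompact K) {v : ℕ → E → ℝ} {C : ℝ≥0}
    (hv : ∀ j, MemLp (v j) 2 μ) (hC : ∀ j, eLpNorm (v j) 2 μ ≤ C)
    (hsupp : ∀ j, Function.support (v j) ⊆ K)
    (hw : ∀ f : E → ℝ, MemLp f 2 μ → ∃ l : ℝ, Tendsto (fun k => ∫ x, v k x * f x ∂μ) atTop (𝓝 l))
    (φ : ContDiffBump (0 : E)) :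
    ∃ L : E → ℝ, AEStronglyMeasurable L μ ∧
      Tendsto (fun k => eLpNorm (mollify μ φ (v k) - L) 2 μ) atTop (𝓝 0) := by
  have hρ : ∀ x, MemLp (fun y => φ.normed μ (x - y)) 2 μ := fun x =>
    Continuous.memLp_of_hasCompactSupport (φ.continuous_normed.comp (by fun_prop))
      ((φ.hasCompactSupport_normed (μ := μ)).comp_homeomorph (Homeomorph.subLeft x))
  choose L hL using fun x => hw _ (hρ x)
  have hL' : ∀ x, Tendsto (fun k => mollify μ φ (v k) x) atTop (𝓝 (L x)) := by
    intro x
    refine (hL x).congr fun k => ?_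
    rw [mollify_apply']
    simp [mul_comm]
  have hmeas : ∀ k, AEStronglyMeasurable (mollify μ φ (v k)) μ := fun k =>
    (contDiff_mollify ((hv k).locallyIntegrable (by norm_num)) φ).continuous.aestronglyMeasurable
  have hLm : AEStronglyMeasurable L μ :=
    aestronglyMeasurable_of_tendsto_ae atTop hmeas (Eventually.of_forall hL')
  refine ⟨L, hLm, ?_⟩
  obtain ⟨S, hS⟩ := enorm_mollify_le (μ := μ) φ
  set B : ℝ≥0∞ := (S * (C : ℝ≥0∞) ^ 2) ^ (1 / 2 : ℝ) with hB
  have hBtop : B ≠ ⊤ := by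
    apply ENNReal.rpow_ne_top_of_nonneg (by norm_num)
    exact ENNReal.mul_ne_top ENNReal.coe_ne_top (by simp)
  have hb : ∀ k x, ‖mollify μ φ (v k) x‖ₑ ≤ B := by
    intro k x
    rw [hB, one_div, ENNReal.le_rpow_inv_iff (by norm_num)]
    rw [ENNReal.rpow_ofNat]
    exact (hS _ (hv k).1 x).trans (by gcongr; exact hC k)
  have hbL : ∀ x, ‖L x‖ₑ ≤ B := fun x => le_of_tendsto' (hL' x).enorm fun k => hb k x
  set K' := Metric.cthickening φ.rOut K with hK'
  have hK'c : IsCompact K' := hK.cthickening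
  have hLz : ∀ x, x ∉ K' → L x = 0 := fun x hx =>
    tendsto_nhds_unique (hL' x) (by simp [mollify_eq_zero_of_notMem (hsupp _) φ hx])
  have key : Tendsto (fun k => ∫⁻ x, ‖(mollify μ φ (v k) - L) x‖ₑ ^ 2 ∂μ) atTop
      (𝓝 (∫⁻ _, 0 ∂μ)) := by
    refine tendsto_lintegral_of_dominated_convergence' (K'.indicator fun _ => (B + B) ^ 2)
      (fun k => ((hmeas k).sub hLm).enorm.pow_const 2) (fun k => Eventually.of_forall fun x => ?_)
      ?_ (Eventually.of_forall fun x => ?_)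
    · by_cases hx : x ∈ K'
      · rw [Set.indicator_of_mem hx]
        exact pow_le_pow_left' (enorm_sub_le.trans (add_le_add (hb k x) (hbL x))) 2
      · simp [hLz x hx, mollify_eq_zero_of_notMem (hsupp _) φ hx]
    · rw [lintegral_indicator hK'c.measurableSet, lintegral_const]
      refine ENNReal.mul_ne_top (ENNReal.pow_ne_top (by simp [hBtop])) ?_
      simpa using hK'c.measure_ne_top
    · have := ((ENNReal.continuous_pow 2).tendsto _).comp ((hL' x).sub_const (L x)).enorm
      simpa [Function.comp_def] using this
  simp_rw [← eLpNorm_two_sq_eq_lintegral, lintegral_zero] at key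
  have h2 := key.ennrpow_const (1 / 2 : ℝ)
  rw [ENNReal.zero_rpow_of_pos (by norm_num)] at h2
  refine h2.congr fun k => ?_
  rw [← ENNReal.rpow_natCast, ← ENNReal.rpow_mul]
  norm_num

/-- The Rellich–Kolmogorov compactness theorem in `L²`. -/
theorem exists_subseq_cauchy_eLpNorm {K : Set E} (hK : IsCompact K) {v : ℕ → E → ℝ} {C M : ℝ≥0}
    (hv : ∀ j, MemLp (v j) 2 μ) (hC : ∀ j, eLpNorm (v j) 2 μ ≤ C)
    (hsupp : ∀ j, Function.support (v j) ⊆ K)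
    (htr : ∀ j y, eLpNorm (fun x => v j (x - y) - v j x) 2 μ ≤ ENNReal.ofReal ‖y‖ * M) :
    ∃ σ : ℕ → ℕ, StrictMono σ ∧ ∀ ε : ℝ≥0∞, 0 < ε →
      ∃ N, ∀ j ≥ N, ∀ k ≥ N, eLpNorm (v (σ j) - v (σ k)) 2 μ ≤ ε := by
  obtain ⟨σ, hσ, hw⟩ := exists_subseq_weakly_convergent hv hC
  refine ⟨σ, hσ, fun ε hε => ?_⟩
  -- Four errors: for each of the two terms, one for mollifying it and one for comparing the result
  -- with `L`.
  have hε4 : 0 < ε / 4 := ENNReal.div_pos hε.ne' (by norm_num)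
  have h0 : Tendsto (fun k => ENNReal.ofReal (bumpSeq E k).rOut * M) atTop (𝓝 0) := by
    have := ENNReal.Tendsto.mul_const (b := (M : ℝ≥0∞))
      (ENNReal.tendsto_ofReal (tendsto_bumpSeq_rOut (E := E))) (Or.inr ENNReal.coe_ne_top)
    simpa using this
  obtain ⟨i, hi⟩ := ((ENNReal.tendsto_nhds_zero.1 h0) _ hε4).exists
  set φ := bumpSeq E i
  obtain ⟨L, hLm, hL⟩ := exists_tendsto_mollify hK (fun j => hv (σ j)) (fun j => hC (σ j))
    (fun j => hsupp (σ j)) hw φ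
  obtain ⟨N, hN⟩ := eventually_atTop.1 ((ENNReal.tendsto_nhds_zero.1 hL) _ hε4)
  have hm : ∀ j, eLpNorm (mollify μ φ (v j) - v j) 2 μ ≤ ε / 4 := fun j =>
    eLpNorm_mollify_sub_le ((hv j).locallyIntegrable (by norm_num)) φ fun y hy =>
      ((htr j y).trans (by gcongr)).trans hi
  have hmeas : ∀ j, AEStronglyMeasurable (mollify μ φ (v j)) μ := fun j =>
    (contDiff_mollify ((hv j).locallyIntegrable (by norm_num)) φ).continuous.aestronglyMeasurable
  have hvL : ∀ j ≥ N, eLpNorm (v (σ j) - L) 2 μ ≤ ε / 4 + ε / 4 := by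
    intro j hj
    have e : v (σ j) - L = (mollify μ φ (v (σ j)) - L) - (mollify μ φ (v (σ j)) - v (σ j)) := by
      abel
    rw [e]
    exact (eLpNorm_sub_le ((hmeas _).sub hLm) ((hmeas _).sub (hv _).1) (by norm_num)).trans
      (add_le_add (hN j hj) (hm _))
  refine ⟨N, fun j hj k hk => ?_⟩
  have e : v (σ j) - v (σ k) = (v (σ j) - L) - (v (σ k) - L) := by abel
  rw [e]
  refine (eLpNorm_sub_le ((hv _).1.sub hLm) ((hv _).1.sub hLm) (by norm_num)).trans
    ((add_le_add (hvL j hj) (hvL k hk)).trans (le_of_eq ?_))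
  rw [show ε / 4 + ε / 4 + (ε / 4 + ε / 4) = 4 * (ε / 4) by ring,
    ENNReal.mul_div_cancel (by norm_num) (by norm_num)]

end Rellich

/-! ### Pairings and completeness in `L²`. -/

section L2

variable {α H : Type*} [MeasurableSpace α] {μ : Measure α} [NormedAddCommGroup H]

lemma MeasureTheory.MemLp.ofReal_integral_norm_sq {f : α → H} (hf : MemLp f 2 μ) :
    ENNReal.ofReal (∫ x, ‖f x‖ ^ 2 ∂μ) = eLpNorm f 2 μ ^ 2 := by
  rw [ofReal_integral_eq_lintegral_ofReal hf.norm.integrable_sq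
    (Eventually.of_forall fun x => by positivity), eLpNorm_two_sq_eq_lintegral]
  refine lintegral_congr fun x => ?_
  rw [ENNReal.ofReal_pow (norm_nonneg _), ofReal_norm]

lemma tendsto_integral_inner [InnerProductSpace ℝ H] {F G : α → H} {g : ℕ → α → H}
    (hF : MemLp F 2 μ) (hG : MemLp G 2 μ) (hg : ∀ k, MemLp (g k) 2 μ)
    (h : Tendsto (fun k => eLpNorm (g k - G) 2 μ) atTop (𝓝 0)) :
    Tendsto (fun k => ∫ x, inner ℝ (F x) (g k x) ∂μ) atTop (𝓝 (∫ x, inner ℝ (F x) (G x) ∂μ)) := by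
  have : Fact (1 ≤ (2 : ℝ≥0∞)) := ⟨by norm_num⟩
  have h1 : Tendsto (fun k => (hg k).toLp (g k)) atTop (𝓝 (hG.toLp G)) := by
    rw [Lp.tendsto_Lp_iff_tendsto_eLpNorm'']
    exact h
  have h2 := (tendsto_const_nhds (x := hF.toLp F)).inner h1 (𝕜 := ℝ)
  have e : ∀ {f : α → H} (hf : MemLp f 2 μ),
      inner ℝ (hF.toLp F) (hf.toLp f) = ∫ x, inner ℝ (F x) (f x) ∂μ := by
    intro f hf
    rw [L2.inner_def]
    refine integral_congr_ae ?_
    filter_upwards [hF.coeFn_toLp, hf.coeFn_toLp] with x h3 h4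
    rw [h3, h4]
  simp_rw [e] at h2
  exact h2

lemma exists_limit_of_cauchy_eLpNorm {f : ℕ → α → H} [CompleteSpace H]
    (hf : ∀ k, MemLp (f k) 2 μ)
    (h : ∀ ε : ℝ≥0∞, 0 < ε → ∃ N, ∀ j ≥ N, ∀ k ≥ N, eLpNorm (f j - f k) 2 μ ≤ ε) :
    ∃ F, MemLp F 2 μ ∧ Tendsto (fun k => eLpNorm (f k - F) 2 μ) atTop (𝓝 0) := by
  have : Fact (1 ≤ (2 : ℝ≥0∞)) := ⟨by norm_num⟩
  have hc : CauchySeq fun k => (hf k).toLp (f k) := by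
    rw [EMetric.cauchySeq_iff]
    intro ε hε
    obtain ⟨δ, hδ, hδε⟩ := exists_between hε
    obtain ⟨N, hN⟩ := h δ hδ
    refine ⟨N, fun j hj k hk => ?_⟩
    rw [Lp.edist_toLp_toLp]
    exact (hN j hj k hk).trans_lt hδε
  obtain ⟨F, hF⟩ := cauchySeq_tendsto_of_complete hc
  refine ⟨F, Lp.memLp F, ?_⟩
  rw [← Lp.toLp_coeFn F (Lp.memLp F), Lp.tendsto_Lp_iff_tendsto_eLpNorm''] at hF
  exact hF

end L2

/-! ### Smooth cutoffs and localization to compact supports. -/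

section Cutoff

variable {n : ℕ} {Ω : Opens (EuclideanSpace ℝ (Fin n))}

lemma exists_contDiff_one_on_compact {K O : Set (EuclideanSpace ℝ (Fin n))} (hK : IsCompact K)
    (hO : IsOpen O) (hKO : K ⊆ O) :
    ∃ η : EuclideanSpace ℝ (Fin n) → ℝ, ContDiff ℝ ∞ η ∧ HasCompactSupport η ∧
      tsupport η ⊆ O ∧ ∀ x ∈ K, η x = 1 := by
  obtain ⟨L, hL, hKL, hLO⟩ := exists_compact_between hK hO hKO
  obtain ⟨f, h1, h0, -⟩ := exists_contMDiffMap_one_nhds_of_subset_interior (n := ⊤)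
    (modelWithCornersSelf ℝ (EuclideanSpace ℝ (Fin n))) hK.isClosed hKL
  have hs : tsupport f ⊆ L := closure_minimal
    (fun x hx => by_contra fun h => hx (h0 x h)) hL.isClosed
  exact ⟨f, f.contMDiff.contDiff, hL.of_isClosed_subset (isClosed_tsupport _) hs,
    hs.trans hLO, fun x hx => h1.self_of_nhdsSet x hx⟩

lemma integrable_smul_of_tsupport_subset {H : Type*} [NormedAddCommGroup H] [NormedSpace ℝ H]
    {f : EuclideanSpace ℝ (Fin n) → H}
    (hf : LocallyIntegrableOn f (Ω : Set (EuclideanSpace ℝ (Fin n))))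
    {θ : EuclideanSpace ℝ (Fin n) → ℝ} (hθ : Continuous θ) (hc : HasCompactSupport θ)
    (hs : tsupport θ ⊆ Ω) : Integrable (fun x => θ x • f x) volume := by
  have h1 : IntegrableOn f (tsupport θ) := hf.integrableOn_compact_subset hs hc
  have h2 : IntegrableOn (fun x => θ x • f x) (tsupport θ) :=
    h1.continuousOn_smul hθ.continuousOn hc
  refine (integrableOn_iff_integrable_of_support_subset ?_).1 h2
  exact (Function.support_smul_subset_left _ _).trans (subset_tsupport _)

lemma memLp_smul_of_tsupport_subset {H : Type*} [NormedAddCommGroup H] [NormedSpace ℝ H]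
    {f : EuclideanSpace ℝ (Fin n) → H} (hf : MemL2loc Ω f)
    {θ : EuclideanSpace ℝ (Fin n) → ℝ} (hθ : Continuous θ) (hc : HasCompactSupport θ)
    (hs : tsupport θ ⊆ Ω) : MemLp (fun x => θ x • f x) 2 volume := by
  have h1 := hf _ hc hs
  obtain ⟨S, hS⟩ := hc.exists_bound_of_continuous hθ
  have h2 : MemLp (fun x => θ x • f x) 2 (volume.restrict (tsupport θ)) :=
    h1.of_le_mul (c := S) (hθ.aestronglyMeasurable.smul h1.1) (Eventually.of_forall fun x => by
      rw [norm_smul]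
      gcongr
      exact hS x)
  have hm : MeasurableSet (tsupport θ) := (isClosed_tsupport _).measurableSet
  rw [← memLp_indicator_iff_restrict hm] at h2
  have hsup : Function.support (fun x => θ x • f x) ⊆ tsupport θ :=
    (Function.support_smul_subset_left _ _).trans (subset_tsupport _)
  rwa [Set.indicator_eq_self.2 hsup] at h2

lemma tsupport_gradient_subset (θ : EuclideanSpace ℝ (Fin n) → ℝ) :
    tsupport (gradient θ) ⊆ tsupport θ := by
  refine closure_minimal (fun x hx => tsupport_fderiv_subset ℝ (f := θ) (subset_tsupport _ ?_))
    (isClosed_tsupport _)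
  intro h
  exact hx (by simp [gradient, h])

lemma gradient_eq_zero_of_notMem_tsupport {θ : EuclideanSpace ℝ (Fin n) → ℝ}
    {x : EuclideanSpace ℝ (Fin n)} (hx : x ∉ tsupport θ) : gradient θ x = 0 :=
  image_eq_zero_of_notMem_tsupport fun h => hx (tsupport_gradient_subset θ h)

lemma ContDiff.continuous_gradient {θ : EuclideanSpace ℝ (Fin n) → ℝ} (hθ : ContDiff ℝ ∞ θ) :
    Continuous (gradient θ) :=
  (InnerProductSpace.toDual ℝ _).symm.continuous.comp (hθ.continuous_fderiv (by norm_num))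

lemma inner_gradient (θ : EuclideanSpace ℝ (Fin n) → ℝ) (x w : EuclideanSpace ℝ (Fin n)) :
    inner ℝ (gradient θ x) w = fderiv ℝ θ x w := by
  simp [gradient]

end Cutoff

/-! ### Calculus of weak gradients and admissible test functions. -/

section WeakGradient

variable {n : ℕ} {Ω U : Opens (EuclideanSpace ℝ (Fin n))} {u u' : EuclideanSpace ℝ (Fin n) → ℝ}
  {g g' : EuclideanSpace ℝ (Fin n) → EuclideanSpace ℝ (Fin n)}

lemma integral_restrict_eq_of_tsupport_subset {H : Type*} [NormedAddCommGroup H] [NormedSpace ℝ H]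
    {f : EuclideanSpace ℝ (Fin n) → H} {θ : EuclideanSpace ℝ (Fin n) → ℝ}
    (hs : tsupport θ ⊆ Ω) (hf : ∀ x ∉ tsupport θ, f x = 0) :
    ∫ x in Ω, f x = ∫ x, f x :=
  setIntegral_eq_integral_of_forall_compl_eq_zero fun x hx => hf x fun h => hx (hs h)

lemma fderiv_apply_eq_zero_of_notMem_tsupport {θ : EuclideanSpace ℝ (Fin n) → ℝ}
    {x : EuclideanSpace ℝ (Fin n)} (hx : x ∉ tsupport θ) (w : EuclideanSpace ℝ (Fin n)) :
    fderiv ℝ θ x w = 0 := by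
  rw [← inner_gradient, gradient_eq_zero_of_notMem_tsupport hx, inner_zero_left]

lemma HasWeakGradient.integral_eq_of_contDiff (h : HasWeakGradient Ω u g)
    {ψ : EuclideanSpace ℝ (Fin n) → ℝ} (hψ : ContDiff ℝ ∞ ψ) (hc : HasCompactSupport ψ)
    (hs : tsupport ψ ⊆ Ω) (w : EuclideanSpace ℝ (Fin n)) :
    ∫ x, u x * fderiv ℝ ψ x w = - ∫ x, ψ x * inner ℝ (g x) w := by
  have := h.integral_eq ⟨ψ, hψ, hc, hs⟩ w
  rw [TestFunction.coe_mk, integral_restrict_eq_of_tsupport_subset hs,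
    integral_restrict_eq_of_tsupport_subset hs] at this
  · exact this
  · intro x hx
    simp [image_eq_zero_of_notMem_tsupport hx]
  · intro x hx
    rw [fderiv_apply_eq_zero_of_notMem_tsupport hx, mul_zero]

lemma HasWeakGradient.mono (h : HasWeakGradient Ω u g)
    (hU : (U : Set (EuclideanSpace ℝ (Fin n))) ⊆ Ω) : HasWeakGradient U u g where
  locallyIntegrableOn := h.locallyIntegrableOn.mono_set hU
  locallyIntegrableOn_grad := h.locallyIntegrableOn_grad.mono_set hU
  integral_eq ψ w := by
    have := h.integral_eq_of_contDiff ψ.contDiff ψ.hasCompactSupport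
      (ψ.tsupport_subset.trans hU) w
    rw [integral_restrict_eq_of_tsupport_subset ψ.tsupport_subset,
      integral_restrict_eq_of_tsupport_subset ψ.tsupport_subset, this]
    · intro x hx
      simp [image_eq_zero_of_notMem_tsupport hx]
    · intro x hx
      rw [fderiv_apply_eq_zero_of_notMem_tsupport hx, mul_zero]

lemma HasWeakGradient.integrable_mul_fderiv (h : HasWeakGradient Ω u g)
    {ψ : EuclideanSpace ℝ (Fin n) → ℝ} (hψ : ContDiff ℝ ∞ ψ) (hc : HasCompactSupport ψ)
    (hs : tsupport ψ ⊆ Ω) (w : EuclideanSpace ℝ (Fin n)) :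
    Integrable (fun x => u x * fderiv ℝ ψ x w) volume := by
  have hs' : tsupport (fun x => fderiv ℝ ψ x w) ⊆ tsupport ψ := tsupport_fderiv_apply_subset ℝ w
  have := integrable_smul_of_tsupport_subset h.locallyIntegrableOn
    (θ := fun x => fderiv ℝ ψ x w) ((hψ.continuous_fderiv (by norm_num)).clm_apply continuous_const)
    (hc.fderiv_apply ℝ w) (hs'.trans hs)
  simpa [mul_comm] using this

lemma HasWeakGradient.integrable_mul_inner (h : HasWeakGradient Ω u g)
    {ψ : EuclideanSpace ℝ (Fin n) → ℝ} (hψ : Continuous ψ) (hc : HasCompactSupport ψ)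
    (hs : tsupport ψ ⊆ Ω) (w : EuclideanSpace ℝ (Fin n)) :
    Integrable (fun x => ψ x * inner ℝ (g x) w) volume := by
  have := (integrable_smul_of_tsupport_subset h.locallyIntegrableOn_grad hψ hc hs).inner_const
    (𝕜 := ℝ) w
  simpa [real_inner_smul_left] using this

lemma HasWeakGradient.sub (h : HasWeakGradient Ω u g) (h' : HasWeakGradient Ω u' g') :
    HasWeakGradient Ω (u - u') (g - g') where
  locallyIntegrableOn := h.locallyIntegrableOn.sub h'.locallyIntegrableOn
  locallyIntegrableOn_grad := h.locallyIntegrableOn_grad.sub h'.locallyIntegrableOn_grad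
  integral_eq ψ w := by
    have e := h.integral_eq ψ w
    have e' := h'.integral_eq ψ w
    have a := h.integrable_mul_fderiv ψ.contDiff ψ.hasCompactSupport ψ.tsupport_subset w
    have a' := h'.integrable_mul_fderiv ψ.contDiff ψ.hasCompactSupport ψ.tsupport_subset w
    have b := h.integrable_mul_inner ψ.continuous ψ.hasCompactSupport ψ.tsupport_subset w
    have b' := h'.integrable_mul_inner ψ.continuous ψ.hasCompactSupport ψ.tsupport_subset w
    simp only [Pi.sub_apply, sub_mul, inner_sub_left, mul_sub]
    rw [integral_sub a.integrableOn a'.integrableOn, integral_sub b.integrableOn b'.integrableOn,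
      e, e']
    ring

/-- The product rule for the weak gradient of a product with a compactly supported smooth
function. -/
lemma HasWeakGradient.mul_contDiff (h : HasWeakGradient Ω u g)
    {η : EuclideanSpace ℝ (Fin n) → ℝ} (hη : ContDiff ℝ ∞ η) (hc : HasCompactSupport η)
    (hs : tsupport η ⊆ Ω) :
    HasWeakGradient ⊤ (fun x => η x * u x) (fun x => η x • g x + u x • gradient η x) where
  locallyIntegrableOn :=
    (integrable_smul_of_tsupport_subset h.locallyIntegrableOn hη.continuous hc
      hs).locallyIntegrable.locallyIntegrableOn _
  locallyIntegrableOn_grad := by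
    refine LocallyIntegrable.locallyIntegrableOn (Integrable.locallyIntegrable ?_) _
    refine (integrable_smul_of_tsupport_subset h.locallyIntegrableOn_grad hη.continuous hc hs).add ?_
    have h1 : IntegrableOn u (tsupport η) := h.locallyIntegrableOn.integrableOn_compact_subset hs hc
    have h2 : IntegrableOn (fun x => u x • gradient η x) (tsupport η) :=
      h1.smul_continuousOn hη.continuous_gradient.continuousOn hc
    refine (integrableOn_iff_integrable_of_support_subset fun x hx => ?_).1 h2
    by_contra hx'
    exact hx (by simp [gradient_eq_zero_of_notMem_tsupport hx'])
  integral_eq ψ w := by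
    simp only [Opens.coe_top, Measure.restrict_univ]
    have hsub : tsupport (fun x => η x * ψ x) ⊆ tsupport η := tsupport_mul_subset_left
    have hp := hη.mul ψ.contDiff
    have hpc : HasCompactSupport (fun x => η x * ψ x) := hc.mul_right
    -- The weak gradient of `u` is tested with `η * ψ`; Leibniz then produces the `gradient η` term.
    have e := h.integral_eq_of_contDiff hp hpc (hsub.trans hs) w
    have hd : ∀ x, fderiv ℝ (fun x => η x * ψ x) x w
        = η x * fderiv ℝ ψ x w + ψ x * fderiv ℝ η x w := by
      intro x
      rw [fderiv_fun_mul (hη.differentiable (by norm_num) x)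
        (ψ.contDiff.differentiable (by norm_num) x)]
      simp
    have i1 := h.integrable_mul_fderiv hp hpc (hsub.trans hs) w
    have i2 : Integrable (fun x => ψ x * (u x * fderiv ℝ η x w)) volume := by
      obtain ⟨S, hS⟩ := ψ.hasCompactSupport.exists_bound_of_continuous ψ.continuous
      exact (h.integrable_mul_fderiv hη hc hs w).bdd_mul ψ.continuous.aestronglyMeasurable
        (Eventually.of_forall hS)
    have i3 := h.integrable_mul_inner hp.continuous hpc (hsub.trans hs) w
    have l : ∀ x, η x * u x * fderiv ℝ ψ x w
        = u x * fderiv ℝ (fun x => η x * ψ x) x w - ψ x * (u x * fderiv ℝ η x w) := by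
      intro x
      rw [hd]
      ring
    have r : ∀ x, ψ x * inner ℝ (η x • g x + u x • gradient η x) w
        = η x * ψ x * inner ℝ (g x) w + ψ x * (u x * fderiv ℝ η x w) := by
      intro x
      rw [inner_add_left, real_inner_smul_left, real_inner_smul_left, inner_gradient]
      ring
    simp_rw [l, r]
    rw [integral_sub i1 i2, integral_add i3 i2, e]
    ring

/-- A weak divergence equation may be tested with compactly supported `W^{1,2}` functions. -/
lemma integral_inner_weakGradient_eq_zero {F : EuclideanSpace ℝ (Fin n) → EuclideanSpace ℝ (Fin n)}
    (hF : MemL2loc Ω F) (heq : ∀ ψ : 𝓓(Ω, ℝ), ∫ x in Ω, inner ℝ (F x) (gradient ψ x) = 0)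
    {K : Set (EuclideanSpace ℝ (Fin n))} (hK : IsCompact K) (hKΩ : K ⊆ Ω)
    (h : HasWeakGradient ⊤ u g) (hu : Function.support u ⊆ K) (hg : MemLp g 2 volume)
    (hgK : Function.support g ⊆ K) :
    ∫ x, inner ℝ (F x) (g x) = 0 := by
  -- The margin `δ` keeps mollifications of `u` supported in `Ω`, hence admissible as test
  -- functions, once the radius is below `δ`.
  obtain ⟨δ, hδ, hδΩ⟩ := hK.exists_cthickening_subset_open Ω.isOpen hKΩ
  set K' := Metric.cthickening δ K with hK'
  have hK'c : IsCompact K' := hK.cthickening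
  -- Truncation makes `F` globally square integrable and does not affect pairings with fields
  -- vanishing off `K'`.
  have hF' : MemLp (K'.indicator F) 2 volume :=
    (memLp_indicator_iff_restrict hK'c.measurableSet).2 (hF _ hK'c hδΩ)
  have hul : LocallyIntegrable u volume := by
    simpa [locallyIntegrableOn_univ] using h.locallyIntegrableOn
  have hgl : LocallyIntegrable g volume := hg.locallyIntegrable (by norm_num)
  have hlim := tendsto_integral_inner hF' hg (g := fun k => mollify volume (bumpSeq _ k) g)
    (fun k => ⟨(contDiff_mollify hgl _).continuous.aestronglyMeasurable,
      (eLpNorm_mollify_le hg.1 _).trans_lt hg.2⟩) (tendsto_eLpNorm_mollify_sub hg)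
  have hz : ∀ᶠ k in atTop, ∫ x, inner ℝ (K'.indicator F x) (mollify volume (bumpSeq _ k) g x) = 0 := by
    filter_upwards [(tendsto_bumpSeq_rOut (E := EuclideanSpace ℝ (Fin n))).eventually_lt_const hδ]
      with k hk
    have hs : tsupport (mollify volume (bumpSeq _ k) u) ⊆ K' := by
      refine closure_minimal (fun x hx => ?_) hK'c.isClosed
      by_contra hx'
      exact hx (mollify_eq_zero_of_notMem hu _
        fun hx'' => hx' (Metric.cthickening_mono hk.le K hx''))
    have e := heq ⟨mollify volume (bumpSeq _ k) u, contDiff_mollify hul _,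
      hK'c.of_isClosed_subset (isClosed_tsupport _) hs, hs.trans hδΩ⟩
    change ∫ x in Ω, inner ℝ (F x) (gradient (mollify volume (bumpSeq _ k) u) x) = 0 at e
    rw [integral_restrict_eq_of_tsupport_subset (hs.trans hδΩ)] at e
    · rw [← e]
      refine integral_congr_ae (Eventually.of_forall fun x => ?_)
      simp only [← h.gradient_mollify]
      by_cases hx : x ∈ K'
      · rw [Set.indicator_of_mem hx]
      · rw [gradient_eq_zero_of_notMem_tsupport fun h => hx (hs h), inner_zero_right,
          inner_zero_right]
    · intro x hx
      rw [gradient_eq_zero_of_notMem_tsupport hx, inner_zero_right]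
  have h0 := tendsto_nhds_unique (hlim.congr' hz) tendsto_const_nhds
  rw [← h0]
  refine integral_congr_ae (Eventually.of_forall fun x => ?_)
  by_cases hx : x ∈ K'
  · simp only [Set.indicator_of_mem hx]
  · have : g x = 0 := by
      by_contra h
      exact hx (Metric.self_subset_cthickening K (hgK h))
    simp [this]

end WeakGradient

/-! ### Caccioppoli's inequality. -/

section Caccioppoli

variable {n : ℕ} {Ω : Opens (EuclideanSpace ℝ (Fin n))} {u : EuclideanSpace ℝ (Fin n) → ℝ}
  {g : EuclideanSpace ℝ (Fin n) → EuclideanSpace ℝ (Fin n)}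
  {A : EuclideanSpace ℝ (Fin n) → EuclideanSpace ℝ (Fin n) →L[ℝ] EuclideanSpace ℝ (Fin n)}
  {lam Lam : ℝ}

lemma hasCompactSupport_gradient {θ : EuclideanSpace ℝ (Fin n) → ℝ} (hc : HasCompactSupport θ) :
    HasCompactSupport (gradient θ) :=
  IsCompact.of_isClosed_subset hc (isClosed_tsupport _) (tsupport_gradient_subset θ)

lemma memLp_smul_gradient (hu : MemL2loc Ω u) {θ : EuclideanSpace ℝ (Fin n) → ℝ}
    (hθ : ContDiff ℝ ∞ θ) (hc : HasCompactSupport θ) (hs : tsupport θ ⊆ Ω) :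
    MemLp (fun x => u x • gradient θ x) 2 volume := by
  have h1 := hu _ hc hs
  obtain ⟨S, hS⟩ := (hasCompactSupport_gradient hc).exists_bound_of_continuous
    hθ.continuous_gradient
  have h2 : MemLp (fun x => u x • gradient θ x) 2 (volume.restrict (tsupport θ)) :=
    h1.of_le_mul (c := S) (h1.1.smul hθ.continuous_gradient.aestronglyMeasurable)
      (Eventually.of_forall fun x => by
        rw [norm_smul, mul_comm]
        gcongr
        exact hS x)
  rw [← memLp_indicator_iff_restrict (isClosed_tsupport _).measurableSet] at h2
  have hsup : Function.support (fun x => u x • gradient θ x) ⊆ tsupport θ := fun x hx =>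
    tsupport_gradient_subset θ (subset_tsupport _ fun h => hx (by simp [h]))
  rwa [Set.indicator_eq_self.2 hsup] at h2

lemma memLp_clm_apply {s : Set (EuclideanSpace ℝ (Fin n))}
    (hA : AEStronglyMeasurable A (volume.restrict s))
    (hAb : ∀ᵐ x ∂(volume.restrict s), ‖A x‖ ≤ Lam) (hg : MemLp g 2 (volume.restrict s)) :
    MemLp (fun x => A x (g x)) 2 (volume.restrict s) := by
  refine hg.of_le_mul (c := Lam)
    (isBoundedBilinearMap_apply.continuous.comp_aestronglyMeasurable (hA.prodMk hg.1)) ?_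
  filter_upwards [hAb] with x hx
  exact (A x).le_of_opNorm_le hx _

/-- The pointwise estimate behind Caccioppoli's inequality. -/
lemma caccioppoli_pointwise {V : Type*} [NormedAddCommGroup V] [InnerProductSpace ℝ V]
    {B : V →L[ℝ] V} (hlam : 0 < lam) (hB : ∀ v, lam * ‖v‖ ^ 2 ≤ inner ℝ (B v) v)
    (hBn : ‖B‖ ≤ Lam) {p q : V} {S t r : ℝ} (hq : ‖q‖ ≤ S) :
    ‖t • p‖ ^ 2 ≤ 2 / lam * inner ℝ (B p) (t ^ 2 • p + r • ((2 * t) • q))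
      + (2 * Lam * S / lam) ^ 2 * r ^ 2 := by
  have h1 := hB p
  have h2 : |inner ℝ (B p) q| ≤ Lam * ‖p‖ * S :=
    (abs_real_inner_le_norm _ _).trans (mul_le_mul (B.le_of_opNorm_le hBn p) hq (norm_nonneg _)
      (mul_nonneg ((norm_nonneg _).trans hBn) (norm_nonneg _)))
  have h3 : - (2 * r * t * inner ℝ (B p) q) ≤ 2 * |r| * |t| * (Lam * ‖p‖ * S) := by
    refine (neg_le_abs _).trans ?_
    rw [abs_mul, abs_mul, abs_mul, abs_two]
    gcongr
  -- Young's inequality with weight `lam / 2`, by completing the square: half of the ellipticity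
  -- absorbs the cross term, and the later factor `2 / lam` yields the constant `(2 * Lam * S / lam)
  -- ^ 2`.
  have h4 : 2 * |r| * |t| * (Lam * ‖p‖ * S)
      ≤ lam / 2 * (t ^ 2 * ‖p‖ ^ 2) + 2 / lam * (Lam * S * r) ^ 2 := by
    have e : lam / 2 * (t ^ 2 * ‖p‖ ^ 2) + 2 / lam * (Lam * S * r) ^ 2
        - 2 * |r| * |t| * (Lam * ‖p‖ * S)
        = (lam * |t| * ‖p‖ - 2 * Lam * S * |r|) ^ 2 / (2 * lam) := by
      field_simp
      rw [← sq_abs t, ← sq_abs r]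
      ring
    have : 0 ≤ (lam * |t| * ‖p‖ - 2 * Lam * S * |r|) ^ 2 / (2 * lam) := by positivity
    linarith
  rw [norm_smul, mul_pow, Real.norm_eq_abs, sq_abs, inner_add_right, real_inner_smul_right,
    real_inner_smul_right, real_inner_smul_right]
  have h5 : t ^ 2 * (lam * ‖p‖ ^ 2) ≤ t ^ 2 * inner ℝ (B p) p := by gcongr
  have h6 : lam / 2 * (t ^ 2 * ‖p‖ ^ 2) ≤ t ^ 2 * inner ℝ (B p) p + r * (2 * t * inner ℝ (B p) q)
      + 2 / lam * (Lam * S * r) ^ 2 := by nlinarith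
  have h7 := mul_le_mul_of_nonneg_left h6 (show 0 ≤ 2 / lam by positivity)
  refine (le_of_eq ?_).trans (h7.trans (le_of_eq ?_))
  · field_simp
  · field_simp

/-- Caccioppoli's inequality. -/
lemma eLpNorm_smul_weakGradient_le
    (hA : AEStronglyMeasurable A (volume.restrict (Ω : Set (EuclideanSpace ℝ (Fin n)))))
    (hlam : 0 < lam) (hLam : 0 ≤ Lam)
    (hell : ∀ᵐ x ∂(volume.restrict (Ω : Set (EuclideanSpace ℝ (Fin n)))),
      (∀ v, lam * ‖v‖ ^ 2 ≤ inner ℝ (A x v) v) ∧ ‖A x‖ ≤ Lam)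
    (hu : MemL2loc Ω u) (h : HasWeakGradient Ω u g) (hg : MemL2loc Ω g)
    (heq : ∀ ψ : 𝓓(Ω, ℝ), ∫ x in Ω, inner ℝ (A x (g x)) (gradient ψ x) = 0)
    {η : EuclideanSpace ℝ (Fin n) → ℝ} (hη : ContDiff ℝ ∞ η) (hc : HasCompactSupport η)
    (hs : tsupport η ⊆ Ω) {S : ℝ} (hS : ∀ x, ‖gradient η x‖ ≤ S) :
    eLpNorm (fun x => η x • g x) 2 volume
      ≤ ENNReal.ofReal (2 * Lam * S / lam) * eLpNorm u 2 (volume.restrict (tsupport η)) := by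
  set K := tsupport η with hK
  have hKm : MeasurableSet K := (isClosed_tsupport _).measurableSet
  have hS0 : 0 ≤ S := (norm_nonneg _).trans (hS 0)
  have hη2 : ContDiff ℝ ∞ (fun x => η x ^ 2) := hη.pow 2
  have hs2 : tsupport (fun x => η x ^ 2) ⊆ K :=
    closure_mono fun x hx hx0 => hx (by simp [hx0])
  have hc2 : HasCompactSupport (fun x => η x ^ 2) :=
    hc.of_isClosed_subset (isClosed_tsupport _) hs2
  have hgrad : ∀ x, gradient (fun x => η x ^ 2) x = (2 * η x) • gradient η x := by
    intro x
    refine HasGradientAt.gradient ?_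
    rw [hasGradientAt_iff_hasFDerivAt]
    have := ((hη.differentiable (by norm_num) x).hasFDerivAt).pow 2
    refine this.congr_fderiv ?_
    ext1 w
    simp [gradient]
  set F := fun x => A x (g x) with hFdef
  have hF : MemL2loc Ω F := fun L hL hLΩ =>
    memLp_clm_apply (hA.mono_set hLΩ)
      (ae_restrict_of_ae_restrict_of_subset hLΩ (hell.mono fun x hx => hx.2)) (hg L hL hLΩ)
  -- The weak gradient of the test function `η ^ 2 * u`; squaring `η` leaves one factor of `η` in
  -- the cross term, to be absorbed.
  set G := fun x => η x ^ 2 • g x + u x • gradient (fun x => η x ^ 2) x with hG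
  have hGm : MemLp G 2 volume :=
    (memLp_smul_of_tsupport_subset hg hη2.continuous hc2 (hs2.trans hs)).add
      (memLp_smul_gradient hu hη2 hc2 (hs2.trans hs))
  have hzero : ∀ x ∉ K, η x = 0 := fun x hx => image_eq_zero_of_notMem_tsupport hx
  have hGz : ∀ x ∉ K, G x = 0 := fun x hx => by
    simp only [hG, hgrad, hzero x hx]
    simp
  have htest : ∫ x, inner ℝ (F x) (G x) = 0 :=
    integral_inner_weakGradient_eq_zero hF heq hc hs
      (h.mul_contDiff hη2 hc2 (hs2.trans hs))
      (fun x hx => by_contra fun hx' => hx (by simp [hzero x hx'])) hGm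
      (fun x hx => by_contra fun hx' => hx (hGz x hx'))
  have hFK : MemLp (K.indicator F) 2 volume := (memLp_indicator_iff_restrict hKm).2 (hF K hc hs)
  have hind : ∀ x, inner ℝ (K.indicator F x) (G x) = inner ℝ (F x) (G x) := by
    intro x
    by_cases hx : x ∈ K
    · rw [Set.indicator_of_mem hx]
    · rw [hGz x hx, inner_zero_right, inner_zero_right]
  have hInt : Integrable (fun x => inner ℝ (F x) (G x)) volume := by
    simp_rw [← hind]
    refine (hFK.norm.integrable_mul hGm.norm).mono (hFK.1.inner hGm.1)
      (Eventually.of_forall fun x => ?_)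
    refine (norm_inner_le_norm _ _).trans (le_abs_self _)
  have huK : MemLp (K.indicator u) 2 volume := (memLp_indicator_iff_restrict hKm).2 (hu K hc hs)
  have hηg : MemLp (fun x => η x • g x) 2 volume :=
    memLp_smul_of_tsupport_subset hg hη.continuous hc hs
  have hle : ∫ x, ‖η x • g x‖ ^ 2 ≤ (2 * Lam * S / lam) ^ 2 * ∫ x, ‖K.indicator u x‖ ^ 2 := by
    calc ∫ x, ‖η x • g x‖ ^ 2
        ≤ ∫ x, (2 / lam * inner ℝ (F x) (G x)
          + (2 * Lam * S / lam) ^ 2 * ‖K.indicator u x‖ ^ 2) := by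
          refine integral_mono_ae hηg.norm.integrable_sq
            ((hInt.const_mul _).add (huK.norm.integrable_sq.const_mul _)) ?_
          filter_upwards [(ae_restrict_iff' Ω.isOpen.measurableSet).1 hell] with x hx
          by_cases hxK : x ∈ K
          · obtain ⟨h1, h2⟩ := hx (hs hxK)
            rw [Set.indicator_of_mem hxK]
            simp only [hG, hgrad, Real.norm_eq_abs, sq_abs]
            exact caccioppoli_pointwise hlam h1 h2 (hS x)
          · simp [hzero x hxK, hGz x hxK, Set.indicator_of_notMem hxK]
      _ = (2 * Lam * S / lam) ^ 2 * ∫ x, ‖K.indicator u x‖ ^ 2 := by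
          rw [integral_add (hInt.const_mul _) (huK.norm.integrable_sq.const_mul _),
            integral_const_mul, integral_const_mul, htest]
          ring
  rw [← ENNReal.pow_le_pow_left_iff two_ne_zero, ← hηg.ofReal_integral_norm_sq, mul_pow,
    ← eLpNorm_indicator_eq_eLpNorm_restrict hKm, ← huK.ofReal_integral_norm_sq,
    ← ENNReal.ofReal_pow (by positivity), ← ENNReal.ofReal_mul (by positivity)]
  exact ENNReal.ofReal_le_ofReal hle

end Caccioppoli

/-! ### Compactness of localized solutions and passage to the limit. -/

section Compactness

variable {n : ℕ} {Ω U : Opens (EuclideanSpace ℝ (Fin n))}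
  {A : EuclideanSpace ℝ (Fin n) → EuclideanSpace ℝ (Fin n) →L[ℝ] EuclideanSpace ℝ (Fin n)}
  {lam Lam : ℝ} {u : ℕ → EuclideanSpace ℝ (Fin n) → ℝ}
  {g : ℕ → EuclideanSpace ℝ (Fin n) → EuclideanSpace ℝ (Fin n)}

lemma eLpNorm_smul_le_restrict {H : Type*} [NormedAddCommGroup H] [NormedSpace ℝ H]
    {f : EuclideanSpace ℝ (Fin n) → ℝ} {V : EuclideanSpace ℝ (Fin n) → H} {S : ℝ}
    (hV : ∀ x, ‖V x‖ ≤ S) :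
    eLpNorm (fun x => f x • V x) 2 volume
      ≤ ENNReal.ofReal S * eLpNorm f 2 (volume.restrict (tsupport V)) := by
  rw [← eLpNorm_indicator_eq_eLpNorm_restrict (isClosed_tsupport _).measurableSet]
  refine eLpNorm_le_mul_eLpNorm_of_ae_le_mul (Eventually.of_forall fun x => ?_) _
  by_cases hx : x ∈ tsupport V
  · rw [Set.indicator_of_mem hx, norm_smul, mul_comm]
    gcongr
    exact hV x
  · simp [image_eq_zero_of_notMem_tsupport hx, Set.indicator_of_notMem hx]

/-- The weak gradient of `η * u j` has two parts: `η • g j`, bounded by Caccioppoli, and `u j •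
gradient η`, bounded by the local `L²` bound. Both bounds are uniform in `j`, so translations are
uniformly controlled and Rellich applies. -/
lemma exists_subseq_cauchy_mul_cutoff
    (hA : AEStronglyMeasurable A (volume.restrict (Ω : Set (EuclideanSpace ℝ (Fin n)))))
    (hlam : 0 < lam) (hLam : 0 ≤ Lam)
    (hell : ∀ᵐ x ∂(volume.restrict (Ω : Set (EuclideanSpace ℝ (Fin n)))),
      (∀ v, lam * ‖v‖ ^ 2 ≤ inner ℝ (A x v) v) ∧ ‖A x‖ ≤ Lam)
    (hu : ∀ j, MemL2loc Ω (u j))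
    (hu_bdd : ∀ K : Set (EuclideanSpace ℝ (Fin n)), IsCompact K → K ⊆ Ω →
      ∃ C : ℝ≥0, ∀ j, eLpNorm (u j) 2 (volume.restrict K) ≤ C)
    (h : ∀ j, HasWeakGradient Ω (u j) (g j)) (hg : ∀ j, MemL2loc Ω (g j))
    (heq : ∀ j, ∀ ψ : 𝓓(Ω, ℝ), ∫ x in Ω, inner ℝ (A x (g j x)) (gradient ψ x) = 0)
    {η : EuclideanSpace ℝ (Fin n) → ℝ} (hη : ContDiff ℝ ∞ η) (hc : HasCompactSupport η)
    (hs : tsupport η ⊆ Ω) :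
    ∃ σ : ℕ → ℕ, StrictMono σ ∧ ∀ ε : ℝ≥0∞, 0 < ε → ∃ N, ∀ j ≥ N, ∀ k ≥ N,
      eLpNorm ((fun x => η x * u (σ j) x) - (fun x => η x * u (σ k) x)) 2 volume ≤ ε := by
  obtain ⟨C, hC⟩ := hu_bdd _ hc hs
  obtain ⟨T, hT⟩ := hc.exists_bound_of_continuous hη.continuous
  obtain ⟨S, hS⟩ := (hasCompactSupport_gradient hc).exists_bound_of_continuous
    hη.continuous_gradient
  set B : ℝ≥0∞ := ENNReal.ofReal (2 * Lam * S / lam) * C + ENNReal.ofReal S * C with hB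
  have hBtop : B ≠ ⊤ := ENNReal.add_ne_top.2
    ⟨ENNReal.mul_ne_top ENNReal.ofReal_ne_top ENNReal.coe_ne_top,
      ENNReal.mul_ne_top ENNReal.ofReal_ne_top ENNReal.coe_ne_top⟩
  have hv : ∀ j, MemLp (fun x => η x * u j x) 2 volume := fun j =>
    memLp_smul_of_tsupport_subset (hu j) hη.continuous hc hs
  have hvC : ∀ j, eLpNorm (fun x => η x * u j x) 2 volume ≤ (Real.toNNReal T * C : ℝ≥0) := by
    intro j
    simp_rw [mul_comm (η _)]
    refine (eLpNorm_smul_le_restrict (f := u j) hT).trans ?_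
    rw [ENNReal.coe_mul]
    exact mul_le_mul_right (hC j) _
  have hG : ∀ j, eLpNorm (fun x => η x • g j x + u j x • gradient η x) 2 volume ≤ B := by
    intro j
    refine (eLpNorm_add_le
      (memLp_smul_of_tsupport_subset (hg j) hη.continuous hc hs).1
      (memLp_smul_gradient (hu j) hη hc hs).1 (by norm_num)).trans (add_le_add ?_ ?_)
    · exact (eLpNorm_smul_weakGradient_le hA hlam hLam hell (hu j) (h j) (hg j) (heq j) hη hc hs
        hS).trans (mul_le_mul_right (hC j) _)
    · refine (eLpNorm_smul_le_restrict (f := u j) hS).trans (mul_le_mul_right ?_ _)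
      exact (eLpNorm_mono_measure _
        (Measure.restrict_mono_set _ (tsupport_gradient_subset η))).trans (hC j)
  refine exists_subseq_cauchy_eLpNorm (K := tsupport η) (C := Real.toNNReal T * C)
    (M := B.toNNReal) (v := fun j x => η x * u j x) hc hv hvC (fun j x hx => ?_) fun j y => ?_
  · by_contra hx'
    exact hx (by simp [image_eq_zero_of_notMem_tsupport hx'])
  · rw [ENNReal.coe_toNNReal hBtop]
    exact (((h j).mul_contDiff hη hc hs).eLpNorm_translate_sub_le (hv j) y).trans
      (mul_le_mul_right (hG j) _)

/-- Weak gradients are closed under `L²` convergence. -/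
lemma HasWeakGradient.of_tendsto {w : EuclideanSpace ℝ (Fin n) → ℝ}
    {G : EuclideanSpace ℝ (Fin n) → EuclideanSpace ℝ (Fin n)}
    (h : ∀ j, HasWeakGradient U (u j) (g j))
    (hu : ∀ j, MemLp (u j) 2 (volume.restrict (U : Set (EuclideanSpace ℝ (Fin n)))))
    (hg : ∀ j, MemLp (g j) 2 (volume.restrict (U : Set (EuclideanSpace ℝ (Fin n)))))
    (hw : MemLp w 2 (volume.restrict (U : Set (EuclideanSpace ℝ (Fin n)))))
    (hG : MemLp G 2 (volume.restrict (U : Set (EuclideanSpace ℝ (Fin n)))))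
    (huw : Tendsto (fun k => eLpNorm (u k - w) 2
      (volume.restrict (U : Set (EuclideanSpace ℝ (Fin n))))) atTop (𝓝 0))
    (hgG : Tendsto (fun k => eLpNorm (g k - G) 2
      (volume.restrict (U : Set (EuclideanSpace ℝ (Fin n))))) atTop (𝓝 0)) :
    HasWeakGradient U w G where
  locallyIntegrableOn :=
    locallyIntegrableOn_of_locallyIntegrable_restrict (hw.locallyIntegrable (by norm_num))
  locallyIntegrableOn_grad :=
    locallyIntegrableOn_of_locallyIntegrable_restrict (hG.locallyIntegrable (by norm_num))
  integral_eq ψ v := by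
    have h1 : MemLp (fun x => fderiv ℝ ψ x v) 2
        (volume.restrict (U : Set (EuclideanSpace ℝ (Fin n)))) :=
      (Continuous.memLp_of_hasCompactSupport
        ((ψ.contDiff.continuous_fderiv (by norm_num)).clm_apply continuous_const)
        (ψ.hasCompactSupport.fderiv_apply ℝ v)).restrict _
    have h2 : MemLp (fun x => ψ x • v) 2
        (volume.restrict (U : Set (EuclideanSpace ℝ (Fin n)))) :=
      (Continuous.memLp_of_hasCompactSupport (ψ.continuous.smul continuous_const)
        ψ.hasCompactSupport.smul_right).restrict _
    have t1 := tendsto_integral_inner h1 hw hu huw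
    have t2 := (tendsto_integral_inner h2 hG hg hgG).neg
    have e1 : ∀ f : EuclideanSpace ℝ (Fin n) → ℝ,
        ∫ x in U, inner ℝ (fderiv ℝ ψ x v) (f x) = ∫ x in U, f x * fderiv ℝ ψ x v := fun f => by
      simp
    have e2 : ∀ f : EuclideanSpace ℝ (Fin n) → EuclideanSpace ℝ (Fin n),
        ∫ x in U, inner ℝ (ψ x • v) (f x) = ∫ x in U, ψ x * inner ℝ (f x) v := fun f => by
      simp only [real_inner_smul_left, real_inner_comm v]
    simp_rw [e1] at t1
    simp_rw [e2] at t2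
    refine tendsto_nhds_unique t1 (t2.congr fun k => ?_)
    exact ((h k).integral_eq ψ v).symm

/-- Multiplication by the bounded field `A` preserves `L²` convergence, and `gradient ψ` is a fixed
`L²` field. -/
lemma integral_inner_eq_zero_of_tendsto
    {G : EuclideanSpace ℝ (Fin n) → EuclideanSpace ℝ (Fin n)}
    (hA : AEStronglyMeasurable A (volume.restrict (U : Set (EuclideanSpace ℝ (Fin n)))))
    (hAb : ∀ᵐ x ∂(volume.restrict (U : Set (EuclideanSpace ℝ (Fin n)))), ‖A x‖ ≤ Lam)
    (heq : ∀ j, ∀ ψ : 𝓓(U, ℝ), ∫ x in U, inner ℝ (A x (g j x)) (gradient ψ x) = 0)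
    (hg : ∀ j, MemLp (g j) 2 (volume.restrict (U : Set (EuclideanSpace ℝ (Fin n)))))
    (hG : MemLp G 2 (volume.restrict (U : Set (EuclideanSpace ℝ (Fin n)))))
    (hgG : Tendsto (fun k => eLpNorm (g k - G) 2
      (volume.restrict (U : Set (EuclideanSpace ℝ (Fin n))))) atTop (𝓝 0)) (ψ : 𝓓(U, ℝ)) :
    ∫ x in U, inner ℝ (A x (G x)) (gradient ψ x) = 0 := by
  have h1 : MemLp (gradient ψ) 2 (volume.restrict (U : Set (EuclideanSpace ℝ (Fin n)))) :=
    (Continuous.memLp_of_hasCompactSupport (ContDiff.continuous_gradient ψ.contDiff)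
      (hasCompactSupport_gradient ψ.hasCompactSupport)).restrict _
  have hlim : Tendsto (fun k => eLpNorm ((fun x => A x (g k x)) - (fun x => A x (G x))) 2
      (volume.restrict (U : Set (EuclideanSpace ℝ (Fin n))))) atTop (𝓝 0) := by
    have h2 := ENNReal.Tendsto.const_mul hgG (Or.inr (ENNReal.ofReal_ne_top (r := Lam)))
    rw [mul_zero] at h2
    refine tendsto_of_tendsto_of_tendsto_of_le_of_le tendsto_const_nhds h2 (fun _ => zero_le) ?_
    intro k
    refine eLpNorm_le_mul_eLpNorm_of_ae_le_mul ?_ _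
    filter_upwards [hAb] with x hx
    simpa [← map_sub] using (A x).le_of_opNorm_le hx (g k x - G x)
  have t := tendsto_integral_inner h1 (memLp_clm_apply hA hAb hG)
    (fun k => memLp_clm_apply hA hAb (hg k)) hlim
  have e : ∀ f : EuclideanSpace ℝ (Fin n) → EuclideanSpace ℝ (Fin n),
      ∫ x in U, inner ℝ (gradient ψ x) (f x) = ∫ x in U, inner ℝ (f x) (gradient ψ x) := fun f => by
    simp only [real_inner_comm (gradient ψ _)]
  simp_rw [e, heq] at t
  exact tendsto_nhds_unique t tendsto_const_nhds

end Compactness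

/-! ### Strong convergence of a subsequence. -/

section Main

variable {n : ℕ} {Ω U : Opens (EuclideanSpace ℝ (Fin n))}
  {A : EuclideanSpace ℝ (Fin n) → EuclideanSpace ℝ (Fin n) →L[ℝ] EuclideanSpace ℝ (Fin n)}
  {lam Lam : ℝ} {u : ℕ → EuclideanSpace ℝ (Fin n) → ℝ}
  {g : ℕ → EuclideanSpace ℝ (Fin n) → EuclideanSpace ℝ (Fin n)}

lemma eLpNorm_restrict_le_of_eq_one {H : Type*} [NormedAddCommGroup H] [NormedSpace ℝ H]
    {s : Set (EuclideanSpace ℝ (Fin n))} (hsm : MeasurableSet s)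
    {η : EuclideanSpace ℝ (Fin n) → ℝ} (h1 : ∀ x ∈ s, η x = 1) (f : EuclideanSpace ℝ (Fin n) → H) :
    eLpNorm f 2 (volume.restrict s) ≤ eLpNorm (fun x => η x • f x) 2 volume := by
  rw [← eLpNorm_indicator_eq_eLpNorm_restrict hsm]
  refine eLpNorm_mono fun x => ?_
  by_cases hx : x ∈ s
  · rw [Set.indicator_of_mem hx, h1 x hx, one_smul]
  · rw [Set.indicator_of_notMem hx, norm_zero]
    exact norm_nonneg _

/-- A locally bounded sequence of weak solutions has a subsequence which, together with its
weak gradients, is Cauchy in `L²` of every relatively compact open subset. -/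
lemma exists_subseq_cauchy_weakSolution
    (hA : AEStronglyMeasurable A (volume.restrict (Ω : Set (EuclideanSpace ℝ (Fin n)))))
    (hlam : 0 < lam) (hLam : 0 ≤ Lam)
    (hell : ∀ᵐ x ∂(volume.restrict (Ω : Set (EuclideanSpace ℝ (Fin n)))),
      (∀ v, lam * ‖v‖ ^ 2 ≤ inner ℝ (A x v) v) ∧ ‖A x‖ ≤ Lam)
    (hu : ∀ j, MemL2loc Ω (u j))
    (hu_bdd : ∀ K : Set (EuclideanSpace ℝ (Fin n)), IsCompact K → K ⊆ Ω →
      ∃ C : ℝ≥0, ∀ j, eLpNorm (u j) 2 (volume.restrict K) ≤ C)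
    (h : ∀ j, HasWeakGradient Ω (u j) (g j)) (hg : ∀ j, MemL2loc Ω (g j))
    (heq : ∀ j, ∀ ψ : 𝓓(Ω, ℝ), ∫ x in Ω, inner ℝ (A x (g j x)) (gradient ψ x) = 0)
    (hUc : IsCompact (closure (U : Set (EuclideanSpace ℝ (Fin n)))))
    (hUΩ : closure (U : Set (EuclideanSpace ℝ (Fin n))) ⊆ Ω) :
    ∃ σ : ℕ → ℕ, StrictMono σ ∧ ∀ ε : ℝ≥0∞, 0 < ε → ∃ N, ∀ j ≥ N, ∀ k ≥ N,
      eLpNorm (u (σ j) - u (σ k)) 2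
        (volume.restrict (U : Set (EuclideanSpace ℝ (Fin n)))) ≤ ε ∧
      eLpNorm (g (σ j) - g (σ k)) 2
        (volume.restrict (U : Set (EuclideanSpace ℝ (Fin n)))) ≤ ε := by
  -- Nested cutoffs: Caccioppoli with `θ` controls gradients on `U` by functions on `tsupport θ`,
  -- where `η = 1` and Rellich has given the Cauchy property.
  obtain ⟨θ, hθ, hθc, hθs, hθ1⟩ := exists_contDiff_one_on_compact hUc Ω.isOpen hUΩ
  obtain ⟨η, hη, hηc, hηs, hη1⟩ := exists_contDiff_one_on_compact hθc Ω.isOpen hθs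
  obtain ⟨S, hS⟩ := (hasCompactSupport_gradient hθc).exists_bound_of_continuous
    hθ.continuous_gradient
  obtain ⟨σ, hσ, hcau⟩ := exists_subseq_cauchy_mul_cutoff hA hlam hLam hell hu hu_bdd h hg heq
    hη hηc hηs
  refine ⟨σ, hσ, fun ε hε => ?_⟩
  -- Adding `1` makes `c` nonzero and at least `1`, so the single threshold `ε / c` serves both
  -- functions and gradients.
  set c : ℝ≥0∞ := ENNReal.ofReal (2 * Lam * S / lam) + 1 with hc
  have hc0 : c ≠ 0 := by simp [hc]
  have hctop : c ≠ ⊤ := by simp [hc]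
  obtain ⟨N, hN⟩ := hcau (ε / c) (ENNReal.div_pos hε.ne' hctop)
  refine ⟨N, fun j hj k hk => ?_⟩
  have hdiff : eLpNorm (u (σ j) - u (σ k)) 2 (volume.restrict (tsupport θ)) ≤ ε / c := by
    refine (eLpNorm_restrict_le_of_eq_one (isClosed_tsupport _).measurableSet hη1 _).trans ?_
    refine (le_of_eq (congrArg (eLpNorm · 2 volume) (funext fun x => ?_))).trans (hN j hj k hk)
    simp [mul_sub]
  have hεc : c * (ε / c) = ε := ENNReal.mul_div_cancel hc0 hctop
  have hUθ : (U : Set (EuclideanSpace ℝ (Fin n))) ⊆ tsupport θ := fun x hx =>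
    subset_tsupport _ (by simp [hθ1 x (subset_closure hx)])
  constructor
  · refine (eLpNorm_mono_measure _ (Measure.restrict_mono_set _ hUθ)).trans (hdiff.trans ?_)
    calc ε / c = 1 * (ε / c) := (one_mul _).symm
      _ ≤ c * (ε / c) := by gcongr; exact le_add_self
      _ = ε := hεc
  · refine (eLpNorm_restrict_le_of_eq_one U.isOpen.measurableSet
      (fun x hx => hθ1 x (subset_closure hx)) _).trans ?_
    have hd : MemL2loc Ω (g (σ j) - g (σ k)) := fun K hK hKΩ =>
      (hg _ K hK hKΩ).sub (hg _ K hK hKΩ)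
    have hdu : MemL2loc Ω (u (σ j) - u (σ k)) := fun K hK hKΩ =>
      (hu _ K hK hKΩ).sub (hu _ K hK hKΩ)
    -- Integrability is needed to split the integral and obtain the equation for the difference.
    have hAg : ∀ i, LocallyIntegrableOn (fun x => A x (g i x))
        (Ω : Set (EuclideanSpace ℝ (Fin n))) := by
      intro i
      rw [locallyIntegrableOn_iff Ω.isOpen.isLocallyClosed]
      intro K hKΩ hK
      have : IsFiniteMeasure (volume.restrict K) := ⟨by simpa using hK.measure_lt_top⟩
      exact (memLp_clm_apply (hA.mono_set hKΩ) (ae_restrict_of_ae_restrict_of_subset hKΩ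
        (hell.mono fun x hx => hx.2)) (hg i K hK hKΩ)).integrable (by norm_num)
    have hint : ∀ i, ∀ ψ : 𝓓(Ω, ℝ), Integrable (fun x => inner ℝ (A x (g i x)) (gradient ψ x))
        (volume.restrict (Ω : Set (EuclideanSpace ℝ (Fin n)))) := by
      intro i ψ
      have hψs : tsupport (fun x => ‖gradient ψ x‖) ⊆ tsupport ψ :=
        (closure_mono fun x hx => by simpa using hx).trans (tsupport_gradient_subset ψ)
      have hcont : Continuous (gradient ψ) := ContDiff.continuous_gradient ψ.contDiff
      have := integrable_smul_of_tsupport_subset (hAg i) hcont.norm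
        (hasCompactSupport_gradient ψ.hasCompactSupport).norm (hψs.trans ψ.tsupport_subset)
      refine Integrable.mono (this.restrict (s := Ω)) ?_ (Eventually.of_forall fun x => ?_)
      · exact (isBoundedBilinearMap_apply.continuous.comp_aestronglyMeasurable
          (hA.prodMk (h i).locallyIntegrableOn_grad.aestronglyMeasurable)).inner
          hcont.aestronglyMeasurable
      · rw [norm_smul, norm_norm, mul_comm]
        exact norm_inner_le_norm _ _
    have hdeq : ∀ ψ : 𝓓(Ω, ℝ),
        ∫ x in Ω, inner ℝ (A x ((g (σ j) - g (σ k)) x)) (gradient ψ x) = 0 := by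
      intro ψ
      simp only [Pi.sub_apply, map_sub, inner_sub_left]
      rw [integral_sub (hint _ ψ) (hint _ ψ), heq, heq, sub_zero]
    refine (eLpNorm_smul_weakGradient_le hA hlam hLam hell hdu ((h _).sub (h _)) hd hdeq
      hθ hθc hθs hS).trans ?_
    calc ENNReal.ofReal (2 * Lam * S / lam)
          * eLpNorm (u (σ j) - u (σ k)) 2 (volume.restrict (tsupport θ))
        ≤ c * (ε / c) := by gcongr; exact le_self_add
      _ = ε := hεc

end Main

theorem mainTheorem3 {n : ℕ} (Ω : Opens (EuclideanSpace ℝ (Fin n)))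
    (hΩ : IsConnected (Ω : Set (EuclideanSpace ℝ (Fin n))))
    (A : EuclideanSpace ℝ (Fin n) → EuclideanSpace ℝ (Fin n) →L[ℝ] EuclideanSpace ℝ (Fin n))
    (hA : MemLp A ∞ (volume.restrict (Ω : Set (EuclideanSpace ℝ (Fin n)))))
    (hA_normal : ∀ᵐ x ∂(volume.restrict (Ω : Set (EuclideanSpace ℝ (Fin n)))),
      IsStarNormal (A x))
    (lam Lam : ℝ) (hlam : 0 < lam) (hle : lam ≤ Lam)
    (hA_elliptic : ∀ᵐ x ∂(volume.restrict (Ω : Set (EuclideanSpace ℝ (Fin n)))),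
      (∀ v, lam * ‖v‖ ^ 2 ≤ inner ℝ (A x v) v) ∧ ‖A x‖ < Lam)
    (u : ℕ → EuclideanSpace ℝ (Fin n) → ℝ)
    (hu : ∀ j, MemW12loc Ω (u j))
    (hu_bdd : ∀ K : Set (EuclideanSpace ℝ (Fin n)), IsCompact K → K ⊆ Ω →
      ∃ C : ℝ≥0, ∀ j, eLpNorm (u j) 2 (volume.restrict K) ≤ C)
    (hu_sol : ∀ j, IsWeakSolutionDiv Ω A (u j))
    (U : Opens (EuclideanSpace ℝ (Fin n)))
    (hU_compact : IsCompact (closure (U : Set (EuclideanSpace ℝ (Fin n)))))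
    (hU_sub : closure (U : Set (EuclideanSpace ℝ (Fin n))) ⊆ Ω)
    (hU_smooth : HasSmoothBoundary U)
    (hU_sc : IsSimplyConnected (U : Set (EuclideanSpace ℝ (Fin n)))) :
    ∃ (σ : ℕ → ℕ) (w : EuclideanSpace ℝ (Fin n) → ℝ), StrictMono σ ∧
      MemW12 U w ∧ IsWeakSolutionDiv U A w ∧
      Tendsto (fun k => eW12norm U (u (σ k) - w)) atTop (𝓝 0) := by
  have hLam : 0 ≤ Lam := hlam.le.trans hle
  have hell := hA_elliptic.mono fun x hx => And.intro hx.1 hx.2.le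
  choose g hgw hg heq using hu_sol
  obtain ⟨σ, hσ, hcau⟩ := exists_subseq_cauchy_weakSolution hA.1 hlam hLam hell
    (fun j => (hu j).1) hu_bdd hgw hg heq hU_compact hU_sub
  have hUΩ : (U : Set (EuclideanSpace ℝ (Fin n))) ⊆ Ω := subset_closure.trans hU_sub
  have huU : ∀ j, MemLp (u j) 2 (volume.restrict (U : Set (EuclideanSpace ℝ (Fin n)))) := fun j =>
    ((hu j).1 _ hU_compact hU_sub).mono_measure (Measure.restrict_mono_set _ subset_closure)
  have hgU : ∀ j, MemLp (g j) 2 (volume.restrict (U : Set (EuclideanSpace ℝ (Fin n)))) := fun j =>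
    (hg j _ hU_compact hU_sub).mono_measure (Measure.restrict_mono_set _ subset_closure)
  obtain ⟨w, hw, huw⟩ := exists_limit_of_cauchy_eLpNorm (fun k => huU (σ k)) fun ε hε =>
    (hcau ε hε).imp fun N hN j hj k hk => (hN j hj k hk).1
  obtain ⟨G, hG, hgG⟩ := exists_limit_of_cauchy_eLpNorm (fun k => hgU (σ k)) fun ε hε =>
    (hcau ε hε).imp fun N hN j hj k hk => (hN j hj k hk).2
  have hgrad : ∀ k, HasWeakGradient U (u (σ k)) (g (σ k)) := fun k => (hgw (σ k)).mono hUΩ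
  have hwG : HasWeakGradient U w G := HasWeakGradient.of_tendsto hgrad (fun k => huU (σ k))
    (fun k => hgU (σ k)) hw hG huw hgG
  have heqU : ∀ k, ∀ ψ : 𝓓(U, ℝ), ∫ x in U, inner ℝ (A x (g (σ k) x)) (gradient ψ x) = 0 := by
    intro k ψ
    have e := heq (σ k) ⟨ψ, ψ.contDiff, ψ.hasCompactSupport, ψ.tsupport_subset.trans hUΩ⟩
    change ∫ x in Ω, inner ℝ (A x (g (σ k) x)) (gradient ψ x) = 0 at e
    have hz : ∀ x ∉ tsupport ψ, inner ℝ (A x (g (σ k) x)) (gradient ψ x) = 0 := fun x hx => by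
      rw [gradient_eq_zero_of_notMem_tsupport hx, inner_zero_right]
    rw [integral_restrict_eq_of_tsupport_subset (ψ.tsupport_subset.trans hUΩ) hz] at e
    rw [integral_restrict_eq_of_tsupport_subset ψ.tsupport_subset hz, e]
  refine ⟨σ, w, hσ, ⟨hw, G, hwG, hG⟩, ⟨G, hwG, fun K _ hKU =>
    hG.mono_measure (Measure.restrict_mono_set _ hKU), ?_⟩, ?_⟩
  · exact integral_inner_eq_zero_of_tendsto (hA.1.mono_set hUΩ)
      (ae_restrict_of_ae_restrict_of_subset hUΩ (hell.mono fun x hx => hx.2)) heqU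
      (fun k => hgU (σ k)) hG hgG
  · have t := ((((ENNReal.continuous_pow 2).tendsto 0).comp huw).add
      (((ENNReal.continuous_pow 2).tendsto 0).comp hgG)).ennrpow_const (1 / 2 : ℝ)
    simp only [ne_eq, OfNat.ofNat_ne_zero, not_false_eq_true, zero_pow, add_zero] at t
    rw [ENNReal.zero_rpow_of_pos (by norm_num)] at t
    refine tendsto_of_tendsto_of_tendsto_of_le_of_le tendsto_const_nhds t (fun _ => zero_le) ?_
    intro k
    -- Any weak gradient bounds the infimum from above, so uniqueness of weak gradients is not
    -- needed.
    exact iInf₂_le (g (σ k) - G) ((hgrad k).sub hwG)
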